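/- **Setting.** A *boolean network* $\mathcal C$ of size $n$ consists of boolean variables $X_1,\dots,X_n$ with constraints $X_i=f_i(X_1,\dots,X_n)$, $f_i:\{0,1\}^n\to\{0,1\}$; it is *acyclic* if each $f_i$ depends only on $X_1,\dots,X_{i-1}$. A *NOR-network* $\mathcal D$ is a boolean network with variables $Y_1,\dots,Y_N$ and constraints $Y_k=\mathsf{NOR}(Y_j : j\in \mathrm{in}(k))$ (the NOR of no inputs is $1$). $\mathcal D$ *implements* $\mathcal C$ via an injection $e:[n]\to[N]$ if, for every $X\in\{0,1\}^n$, there is exactly one assignment $Y$ with $Y_{e(i)}=X_i$ for all $i$ that satisfies the constraints of all $Y_k$ with $k\notin e([n])$, and for this $Y$ one has $\mathsf{NOR}(Y_j: j\in\mathrm{in}(e(i)))=f_i(X)$ for all $i$. An *ROS system* is given by values $v_{bj}\ge 0$ of finitely many bidders $b$ for finitely many items $j$. With multipliers $m=(m_b)$, bidder $b$ bids $m_bv_{bj}$ for item $j$; each item is sold in a second price auction with uniform random tie-breaking, with allocations $x_{bj}$ and payments $p_{bj}$. The dynamics is $\frac{dm_b}{dt}=U_b(m):=\sum_j (v_{bj}x_{bj}(m)-p_{bj}(m))$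 on $[1,\infty)^B$. As $U$ is discontinuous, solutions on $[0,\infty)$ and equilibria are meant in the sense of Filippov. An equilibrium $p$ is *locally stable* if for each $\varepsilon>0$ there is $\delta>0$ such that all solutions starting in $[1,\infty)^B$ within $\delta$ of $p$ stay within $\varepsilon$ of $p$, and for almost all initial conditions in $[1,\infty)^B$ in some neighbourhood of $p$ all solutions converge to $p$. It is *coordinate-wise stable* for a set $J$ of bidders if for almost every sufficiently small perturbation $m$ of $p$ in the coordinates in $J$ (within $[1,\infty)$) one has, for all $b\in J$, $U_b(m)>0$ if $m_b<p_b$ and $U_b(m)<0$ if $m_b>p_b$. **The system $\mathcal S$ of a NOR-network.** Let $1\le \mathsf{floor}<\mathsf{low}<\mathsf{threshold}<\mathsf{high}<\mathsf{low}\cdot\mathsf{threshold}$, $V>0$, $T=\mathsf{threshold}\cdot V$, $C=\mathsf{low}\cdot\mathsf{threshold}\cdot V$. For each variable $Y_k$ there is a variable bidder $y_k$ and eight items: $L_k$, with value $C$ for $y_k$ and $V$ for each $y_i$ with $i\in\mathrm{in}(k)$, $i\ne k$; $F_k$, with value $\mathsf{floor}-1$ for $y_k$; three items $H_k$, $\mathrm{Ceil}_k$,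 $E_k$ with values $T$, $M_k$, $1$ for $y_k$ and reserve prices $C$, $\mathsf{high}\cdot M_k$, $\mathsf{floor}$; and, for each of these three items, one auxiliary item, with two auxiliary bidders that each have value $1$ for the auxiliary item and value equal to the reserve price for the reserved item. All other values are $0$. Here $M_k$ is so large that $(\mathsf{high}-1)M_k$ exceeds the total value of all other items for $y_k$. **Theorem.** Let $\mathcal C$ be an acyclic boolean network. Then there is an acyclic NOR-network with at most two inputs per gate that implements $\mathcal C$ (and admissible parameters for its system exist). Moreover, for every acyclic NOR-network $\mathcal D$ that implements $\mathcal C$ via some $e$, and for all admissible parameters, let $\mathcal S$ be the ROS system of $\mathcal D$. Then $\mathcal C$ and $\mathcal D$ have unique satisfying assignments $X$ and $Y$, $X_i=Y_{e(i)}$ for all $i$, and the vector $p$ with $p_{y_k}=\mathsf{high}$ if $Y_k=1$, $p_{y_k}=\mathsf{low}$ if $Y_k=0$, and $p_b=1$ for every auxiliary bidder $b$, is a locally stable equilibrium of $\mathcal S$, is the only locally stable equilibrium in $[1,\infty)^B$, and is coordinate-wise stable for the set of variable bidders. For almost all initial conditions $m_0\in[1,\infty)^B$ a solution of $\mathcal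 S$ on $[0,\infty)$ with $m(0)=m_0$ exists, and every such solution converges to $p$ as $t\to\infty$. -/

import Mathlib

open MeasureTheory Filter Topology

noncomputable section

/-! ### Boolean networks -/

/-- A boolean network of size `n`: variables `X_i`, each with a constraint `X_i = f_i(X)`. -/
structure BooleanNetwork (n : ℕ) where
  f : Fin n → (Fin n → Bool) → Bool

/-- `X` satisfies every constraint of the network. -/
def BooleanNetwork.Satisfies {n : ℕ} (C : BooleanNetwork n) (X : Fin n → Bool) : Prop :=
  ∀ i, X i = C.f i X

/-- The network is acyclic: `f_i` depends only on the variables with a smaller index. -/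
def BooleanNetwork.Acyclic {n : ℕ} (C : BooleanNetwork n) : Prop :=
  ∀ i X Y, (∀ j, j < i → X j = Y j) → C.f i X = C.f i Y

/-- A network of NOR gates: the constraint of `X_i` is `X_i = NOR (X_j : j ∈ inputs i)`.
The NOR of no inputs is `1`. -/
structure NORNetwork (N : ℕ) where
  inputs : Fin N → Finset (Fin N)

/-- The boolean network given by a NOR network. -/
def NORNetwork.toBooleanNetwork {N : ℕ} (D : NORNetwork N) : BooleanNetwork N where
  f i Y := decide (∀ j ∈ D.inputs i, Y j = false)

/-- `Y` extends the assignment `X` of the distinguished variables `e i` and is consistent with all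
the intermediate gates (those that are not distinguished). -/
def NORNetwork.IsExtension {n N : ℕ} (D : NORNetwork N) (e : Fin n ↪ Fin N)
    (X : Fin n → Bool) (Y : Fin N → Bool) : Prop :=
  (∀ i, Y (e i) = X i) ∧ ∀ g, g ∉ Set.range e → Y g = D.toBooleanNetwork.f g Y

/-- The NOR network `D` implements the boolean network `C`: the variable `X_i` of `C` is the
variable `e i` of `D`, the other variables of `D` are intermediate gates, whose values are
determined by those of the `e i`, and on every assignment `X` the gate `e i` computes `f_i(X)`. -/
def NORNetwork.Implements {n N : ℕ} (D : NORNetwork N) (e : Fin n ↪ Fin N)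
    (C : BooleanNetwork n) : Prop :=
  ∀ X, (∃! Y, D.IsExtension e X Y) ∧
    ∀ Y, D.IsExtension e X Y → ∀ i, D.toBooleanNetwork.f (e i) Y = C.f i X

/-! ### ROS systems -/

/-- An ROS system with bidders `B` and items `I`: the values `v i j ≥ 0` of bidder `i` for item `j`
(scaled so that all return-over-spend targets are `1`). -/
structure ROSSystem (B I : Type) where
  v : B → I → ℝ
  nonneg : ∀ i j, 0 ≤ v i j

namespace ROSSystem

variable {B I : Type} [Fintype B] [Fintype I]

/-- Uniform bid scaling: with multipliers `m`, bidder `i` bids `m i * v i j` for item `j`. -/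
def bid (S : ROSSystem B I) (m : B → ℝ) (i : B) (j : I) : ℝ := m i * S.v i j

/-- The bidders with the highest bid for item `j`. -/
def winners (S : ROSSystem B I) (m : B → ℝ) (j : I) : Set B :=
  {i | ∀ s, S.bid m s j ≤ S.bid m i j}

open Classical in
/-- Allocation of the auction, with uniform random tie-breaking. -/
def alloc (S : ROSSystem B I) (m : B → ℝ) (i : B) (j : I) : ℝ :=
  if i ∈ S.winners m j then 1 / ((S.winners m j).ncard : ℝ) else 0

/-- Payments of the second price auction. -/
def pay (S : ROSSystem B I) (m : B → ℝ) (i : B) (j : I) : ℝ :=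
  S.alloc m i j * ⨆ s : {s : B // s ≠ i}, S.bid m s j

/-- Quasi-linear utilities; the ROS dynamics is `dm_i/dt = U_i(m)`. -/
def utility (S : ROSSystem B I) (m : B → ℝ) (i : B) : ℝ :=
  ∑ j, (S.v i j * S.alloc m i j - S.pay m i j)

end ROSSystem

/-! ### Dynamical systems with discontinuous right-hand side -/

section Dynamics

variable {B : Type} [Fintype B]

/-- The Filippov regularization of a (possibly discontinuous) vector field `U`. -/
def filippov (U : (B → ℝ) → (B → ℝ)) (x : B → ℝ) : Set (B → ℝ) :=
  ⋂ (δ : ℝ) (_ : 0 < δ) (Z : Set (B → ℝ)) (_ : volume Z = 0),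
    closure (convexHull ℝ (U '' (Metric.ball x δ \ Z)))

/-- `m` is a Filippov solution of `dm/dt = U(m)` on `[0, ∞)`: it is locally absolutely continuous
(an indefinite integral) and its derivative `g` lies in the regularized field for almost every
time. -/
def IsSolution (U : (B → ℝ) → (B → ℝ)) (m : ℝ → B → ℝ) : Prop :=
  ∃ g : ℝ → B → ℝ,
    (∀ t, 0 ≤ t → IntervalIntegrable g volume 0 t) ∧
    (∀ t, 0 ≤ t → m t = m 0 + ∫ s in (0 : ℝ)..t, g s) ∧
    ∀ᵐ t : ℝ, 0 ≤ t → g t ∈ filippov U (m t)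

/-- The state space `[1, ∞)^B` of multipliers. -/
def multipliers (B : Type) : Set (B → ℝ) := {m | ∀ b, 1 ≤ m b}

/-- Equilibria: the points at which the constant function is a solution. -/
def IsEquilibrium (U : (B → ℝ) → (B → ℝ)) (p : B → ℝ) : Prop :=
  0 ∈ filippov U p

/-- Local stability of an equilibrium within the state space: solutions that start close to it stay
close to it, and from almost every initial condition close to it they converge to it. -/
def IsLocallyStable (U : (B → ℝ) → (B → ℝ)) (p : B → ℝ) : Prop :=
  IsEquilibrium U p ∧
  (∀ ε > 0, ∃ δ > 0, ∀ m, IsSolution U m → m 0 ∈ Metric.ball p δ ∩ multipliers B →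
    ∀ t, 0 ≤ t → m t ∈ Metric.ball p ε) ∧
  ∃ δ > 0, ∀ᵐ m₀ : B → ℝ, m₀ ∈ Metric.ball p δ ∩ multipliers B →
    ∀ m, IsSolution U m → m 0 = m₀ → Tendsto m atTop (𝓝 p)

open Classical in
/-- Coordinate-wise stability of an equilibrium `p` with respect to perturbations of the
multipliers of the bidders in `J`: for almost every small perturbation, the multiplier of each
bidder in `J` moves strictly towards its equilibrium value. -/
def IsCoordinatewiseStable (U : (B → ℝ) → (B → ℝ)) (J : Set B) (p : B → ℝ) : Prop :=
  IsEquilibrium U p ∧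
  ∃ ε > 0, ∀ᵐ z : J → ℝ, z ∈ Metric.ball (fun j : J => p j) ε ∩ multipliers J →
    ∀ j : J,
      (z j < p j → 0 < U (fun b => if h : b ∈ J then z ⟨b, h⟩ else p b) j) ∧
      (p j < z j → U (fun b => if h : b ∈ J then z ⟨b, h⟩ else p b) j < 0)

end Dynamics

/-! ### The ROS system of a NOR network -/

/-- For each variable there are three items with a reserve price: the item `H` of the NOR gate, the
item that implements the ceiling, and the item `E` that (with `F`) implements the floor. -/
inductive ReservedItem
  | H
  | ceiling
  | E
  deriving DecidableEq

instance : Fintype ReservedItem where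
  elems := {.H, .ceiling, .E}
  complete := by intro r; cases r <;> simp

/-- The items that belong to a variable: the item `L` of its NOR gate, the three items with a
reserve price, for each of these an auxiliary item that implements the reserve price, and the
item `F`. -/
inductive ItemKind
  | L
  | reserved (r : ReservedItem)
  | aux (r : ReservedItem)
  | F
  deriving DecidableEq, Fintype

/-- The items of the system. -/
abbrev GateItem (N : ℕ) : Type := Fin N × ItemKind

/-- The bidders of the system: one variable bidder `x_i` for each variable, and two auxiliary
bidders for each item with a reserve price. -/
abbrev GateBidder (N : ℕ) : Type := Fin N ⊕ (Fin N × ReservedItem × Fin 2)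

/-- The parameters of the construction: the floor, the two values `low` and `high` of the
multipliers that represent the truth values `0` and `1` (`high` is also the ceiling), the threshold
between them, the value `V` of an input bidder for the item `L`, and values `M i` of the ceiling
items that are so large that `(high - 1) * M i` exceeds the total value of all the other items
for `x_i`. -/
structure GateParams {N : ℕ} (D : NORNetwork N) where
  floor : ℝ
  low : ℝ
  threshold : ℝ
  high : ℝ
  V : ℝ
  M : Fin N → ℝ
  one_le_floor : 1 ≤ floor
  floor_lt_low : floor < low
  low_lt_threshold : low < threshold
  threshold_lt_high : threshold < high
  high_lt : high < low * threshold
  V_pos : 0 < V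
  lt_M : ∀ i, low * threshold * V + threshold * V + 1 + (floor - 1)
      + V * ((Finset.univ.filter fun k => i ∈ D.inputs k).card : ℝ) < (high - 1) * M i

namespace GateParams

variable {N : ℕ} {D : NORNetwork N} (P : GateParams D)

/-- The value `T` of the output bidder for the item `H`. -/
def T : ℝ := P.threshold * P.V

/-- The value `C` of the output bidder for the item `L`; also the reserve price of `H`. -/
def C : ℝ := P.low * P.threshold * P.V

/-- The value of the variable bidder `x_i` for its items with a reserve price. -/
def reservedValue (i : Fin N) : ReservedItem → ℝ
  | .H => P.T
  | .ceiling => P.M i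
  | .E => 1

/-- The reserve prices. -/
def reservePrice (i : Fin N) : ReservedItem → ℝ
  | .H => P.C
  | .ceiling => P.high * P.M i
  | .E => P.floor

/-- The values of all bidders for all items. -/
def value : GateBidder N → GateItem N → ℝ
  | .inl i, (k, .L) => if i = k then P.C else if i ∈ D.inputs k then P.V else 0
  | .inl i, (k, .reserved r) => if i = k then P.reservedValue i r else 0
  | .inl i, (k, .F) => if i = k then P.floor - 1 else 0
  | .inl _, (_, .aux _) => 0
  | .inr (i, r, _), (k, .reserved r') => if i = k ∧ r = r' then P.reservePrice i r else 0
  | .inr (i, r, _), (k, .aux r') => if i = k ∧ r = r' then 1 else 0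
  | .inr _, (_, .L) => 0
  | .inr _, (_, .F) => 0

theorem value_nonneg (b : GateBidder N) (j : GateItem N) : 0 ≤ P.value b j := by
  have h1 := P.one_le_floor
  have h2 := P.floor_lt_low
  have h3 := P.low_lt_threshold
  have h4 := P.threshold_lt_high
  have hV := P.V_pos
  have hT : 0 < P.T := mul_pos (by linarith) hV
  have hC : 0 < P.C := mul_pos (mul_pos (by linarith) (by linarith)) hV
  have hM : ∀ i, 0 < P.M i := by
    intro i
    have h5 := P.lt_M i
    have h6 : 0 ≤ P.V * ((Finset.univ.filter fun k => i ∈ D.inputs k).card : ℝ) :=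
      mul_nonneg hV.le (Nat.cast_nonneg _)
    have h7 : 0 < (P.high - 1) * P.M i := by
      have e1 : P.threshold * P.V = P.T := rfl
      have e2 : P.low * P.threshold * P.V = P.C := rfl
      rw [e1, e2] at h5
      linarith
    exact pos_of_mul_pos_right h7 (by linarith)
  have hv : ∀ i r, 0 ≤ P.reservedValue i r := by
    rintro i (_ | _ | _)
    · exact hT.le
    · exact (hM i).le
    · exact zero_le_one
  have hp : ∀ i r, 0 ≤ P.reservePrice i r := by
    rintro i (_ | _ | _)
    · exact hC.le
    · exact mul_nonneg (by linarith) (hM i).le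
    · exact (by linarith : (0 : ℝ) ≤ P.floor)
  rcases b with i | ⟨i, r, s⟩ <;> rcases j with ⟨k, _ | r' | r' | _⟩ <;> simp only [value]
  · split_ifs <;> linarith
  · split_ifs
    · exact hv i r'
    · exact le_rfl
  · exact le_rfl
  · split_ifs <;> linarith
  · exact le_rfl
  · split_ifs
    · exact hp i r
    · exact le_rfl
  · split_ifs <;> norm_num
  · exact le_rfl

/-- The ROS system of a NOR network. -/
def system : ROSSystem (GateBidder N) (GateItem N) where
  v := P.value
  nonneg := P.value_nonneg

/-- The vector of multipliers that encodes an assignment: variable bidders are at `high` or `low`,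
and auxiliary bidders at `1`. -/
def encode (Y : Fin N → Bool) : GateBidder N → ℝ
  | .inl i => if Y i then P.high else P.low
  | .inr _ => 1

end GateParams

end

noncomputable section

/-! ### Filippov regularizations -/

section General

variable {B : Type} [Fintype B]

/-- The closed convex hull of the values of `U` near `x`, outside of an exceptional set. -/
def filippovHull (U : (B → ℝ) → (B → ℝ)) (x : B → ℝ) (δ : ℝ) (Z : Set (B → ℝ)) : Set (B → ℝ) :=
  closure (convexHull ℝ (U '' (Metric.ball x δ \ Z)))

theorem mem_filippov {U : (B → ℝ) → (B → ℝ)} {x g : B → ℝ} :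
    g ∈ filippov U x ↔
      ∀ δ > 0, ∀ Z : Set (B → ℝ), volume Z = 0 → g ∈ filippovHull U x δ Z := by
  simp only [filippov, Set.mem_iInter, filippovHull, gt_iff_lt]

theorem isClosed_filippovHull (U : (B → ℝ) → (B → ℝ)) (x : B → ℝ) (δ : ℝ) (Z : Set (B → ℝ)) :
    IsClosed (filippovHull U x δ Z) := isClosed_closure

theorem convex_filippovHull (U : (B → ℝ) → (B → ℝ)) (x : B → ℝ) (δ : ℝ) (Z : Set (B → ℝ)) :
    Convex ℝ (filippovHull U x δ Z) := (convex_convexHull ℝ _).closure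

theorem filippovHull_mono (U : (B → ℝ) → (B → ℝ)) {x y : B → ℝ} {δ ε : ℝ} {Z W : Set (B → ℝ)}
    (h : Metric.ball x δ ⊆ Metric.ball y ε) (hZ : W ⊆ Z) :
    filippovHull U x δ Z ⊆ filippovHull U y ε W :=
  closure_mono (convexHull_mono (Set.image_mono (Set.sdiff_subset_sdiff h hZ)))

theorem filippovHull_subset {U : (B → ℝ) → (B → ℝ)} {x : B → ℝ} {δ : ℝ} {Z K : Set (B → ℝ)}
    (hK : Convex ℝ K) (hKc : IsClosed K) (h : ∀ y ∈ Metric.ball x δ, U y ∈ K) :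
    filippovHull U x δ Z ⊆ K := by
  refine closure_minimal (convexHull_min ?_ hK) hKc
  rintro _ ⟨y, hy, rfl⟩
  exact h y hy.1

/-- The regularization lies in each closed convex set that contains the values of the field near
the given point. -/
theorem filippov_subset {U : (B → ℝ) → (B → ℝ)} {x : B → ℝ} {K : Set (B → ℝ)}
    (hK : Convex ℝ K) (hKc : IsClosed K) (h : ∀ᶠ y in 𝓝 x, U y ∈ K) : filippov U x ⊆ K := by
  obtain ⟨δ, hδ, hs⟩ := Metric.eventually_nhds_iff_ball.1 h
  intro g hg
  exact filippovHull_subset hK hKc hs (mem_filippov.1 hg δ hδ ∅ (by simp))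

theorem filippov_le {U : (B → ℝ) → (B → ℝ)} {x : B → ℝ} (φ : (B → ℝ) →L[ℝ] ℝ) {c : ℝ}
    (h : ∀ᶠ y in 𝓝 x, φ (U y) ≤ c) {g : B → ℝ} (hg : g ∈ filippov U x) : φ g ≤ c := by
  have : filippov U x ⊆ {y | φ y ≤ c} :=
    filippov_subset (convex_halfSpace_le φ.toLinearMap.isLinear c)
      (isClosed_le φ.continuous continuous_const) h
  exact this hg

theorem filippov_apply_le {U : (B → ℝ) → (B → ℝ)} {x : B → ℝ} (b : B) {c : ℝ}
    (h : ∀ᶠ y in 𝓝 x, U y b ≤ c) {g : B → ℝ} (hg : g ∈ filippov U x) : g b ≤ c :=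
  filippov_le (ContinuousLinearMap.proj b) h hg

theorem le_filippov_apply {U : (B → ℝ) → (B → ℝ)} {x : B → ℝ} (b : B) {c : ℝ}
    (h : ∀ᶠ y in 𝓝 x, c ≤ U y b) {g : B → ℝ} (hg : g ∈ filippov U x) : c ≤ g b := by
  have := filippov_le (U := U) (x := x) (-ContinuousLinearMap.proj b) (c := -c)
    (by simpa using h) hg
  simpa using this

theorem filippov_subset_of_eventuallyEq {U V : (B → ℝ) → (B → ℝ)} {x : B → ℝ}
    (h : ∀ᶠ y in 𝓝 x, V y = U y) : filippov V x ⊆ filippov U x := by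
  obtain ⟨ε, hε, hs⟩ := Metric.eventually_nhds_iff_ball.1 h
  intro g hg
  refine mem_filippov.2 fun δ hδ Z hZ => ?_
  have h1 := mem_filippov.1 hg (min δ ε) (lt_min hδ hε) Z hZ
  have h2 : V '' (Metric.ball x (min δ ε) \ Z) = U '' (Metric.ball x (min δ ε) \ Z) :=
    Set.image_congr fun y hy => hs y (Metric.ball_subset_ball (min_le_right _ _) hy.1)
  rw [filippovHull, h2] at h1
  exact filippovHull_mono U (Metric.ball_subset_ball (min_le_left _ _)) subset_rfl h1

theorem filippov_nonempty {V : (B → ℝ) → (B → ℝ)} {L : ℝ} (hV : ∀ x, ‖V x‖ ≤ L) (x : B → ℝ) :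
    (filippov V x).Nonempty := by
  have hsub : ∀ δ Z, filippovHull V x δ Z ⊆ Metric.closedBall 0 L := fun δ Z =>
    filippovHull_subset (convex_closedBall 0 L) Metric.isClosed_closedBall fun y _ => by
      simpa using hV y
  let ι := {q : ℝ × Set (B → ℝ) // 0 < q.1 ∧ volume q.2 = 0}
  have hι : Nonempty ι := ⟨⟨(1, ∅), by simp⟩⟩
  have key := IsCompact.nonempty_iInter_of_directed_nonempty_isCompact_isClosed
    (fun q : ι => filippovHull V x q.1.1 q.1.2) ?_ ?_ ?_ ?_
  · obtain ⟨g, hg⟩ := key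
    refine ⟨g, mem_filippov.2 fun δ hδ Z hZ => ?_⟩
    exact Set.mem_iInter.1 hg ⟨(δ, Z), hδ, hZ⟩
  · intro q r
    refine ⟨⟨(min q.1.1 r.1.1, q.1.2 ∪ r.1.2), lt_min q.2.1 r.2.1,
      measure_union_null q.2.2 r.2.2⟩, ?_, ?_⟩
    · exact filippovHull_mono V (Metric.ball_subset_ball (min_le_left _ _)) Set.subset_union_left
    · exact filippovHull_mono V (Metric.ball_subset_ball (min_le_right _ _)) Set.subset_union_right
  · intro q
    have h1 : (Metric.ball x q.1.1 \ q.1.2).Nonempty := by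
      by_contra hne
      have h2 : Metric.ball x q.1.1 ⊆ q.1.2 := by
        rwa [Set.not_nonempty_iff_eq_empty, Set.sdiff_eq_empty] at hne
      have h3 := measure_mono_null h2 q.2.2
      exact (Metric.measure_ball_pos volume x q.2.1).ne' h3
    exact ((h1.image V).convexHull).closure
  · intro q
    exact (isCompact_closedBall 0 L).of_isClosed_subset (isClosed_filippovHull _ _ _ _) (hsub _ _)
  · intro q
    exact isClosed_filippovHull _ _ _ _

theorem filippov_norm_le {V : (B → ℝ) → (B → ℝ)} {L : ℝ} (hV : ∀ x, ‖V x‖ ≤ L) {x g : B → ℝ}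
    (hg : g ∈ filippov V x) : ‖g‖ ≤ L := by
  have : filippov V x ⊆ Metric.closedBall 0 L :=
    filippov_subset (convex_closedBall 0 L) Metric.isClosed_closedBall
      (Eventually.of_forall fun y => by simpa using hV y)
  simpa using this hg

/-! ### Solutions -/

namespace IsSolution

variable {U : (B → ℝ) → (B → ℝ)} {m : ℝ → B → ℝ}

theorem mono {V : (B → ℝ) → (B → ℝ)} (hm : IsSolution V m)
    (h : ∀ t, 0 ≤ t → filippov V (m t) ⊆ filippov U (m t)) : IsSolution U m := by
  obtain ⟨g, h1, h2, h3⟩ := hm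
  exact ⟨g, h1, h2, h3.mono fun t ht h0 => h t h0 (ht h0)⟩

theorem continuousOn (hm : IsSolution U m) : ContinuousOn m (Set.Ici 0) := by
  obtain ⟨g, h1, h2, -⟩ := hm
  intro t ht
  have ht' : (0 : ℝ) ≤ t := ht
  have h3 : ContinuousOn m (Set.uIcc 0 (t + 1)) := by
    have := intervalIntegral.continuousOn_primitive_interval'
      (h1 (t + 1) (by linarith)) Set.left_mem_uIcc
    refine (continuousOn_const.add this).congr fun s hs => h2 s ?_
    rw [Set.uIcc_of_le (by linarith)] at hs
    exact hs.1
  rw [Set.uIcc_of_le (by linarith)] at h3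
  refine (h3 t ⟨ht', by linarith⟩).mono_of_mem_nhdsWithin ?_
  have : Set.Iio (t + 1) ∈ 𝓝 t := Iio_mem_nhds (by linarith)
  filter_upwards [self_mem_nhdsWithin, mem_nhdsWithin_of_mem_nhds this] with s hs hs'
  exact ⟨hs, le_of_lt hs'⟩

theorem sub_eq {g : ℝ → B → ℝ} (h1 : ∀ t, 0 ≤ t → IntervalIntegrable g volume 0 t)
    (h2 : ∀ t, 0 ≤ t → m t = m 0 + ∫ s in (0 : ℝ)..t, g s) {s t : ℝ} (hs : 0 ≤ s) (hst : s ≤ t) :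
    IntervalIntegrable g volume s t ∧ m t - m s = ∫ r in s..t, g r := by
  have ht := hs.trans hst
  refine ⟨(h1 s hs).symm.trans (h1 t ht), ?_⟩
  rw [h2 t ht, h2 s hs, add_sub_add_left_eq_sub,
    intervalIntegral.integral_interval_sub_left (h1 t ht) (h1 s hs)]

/-- A bound on the drift along a linear functional bounds its growth. -/
theorem drift (hm : IsSolution U m) (φ : (B → ℝ) →L[ℝ] ℝ) {c s t : ℝ} (hs : 0 ≤ s) (hst : s ≤ t)
    (h : ∀ τ ∈ Set.Ioo s t, ∀ g ∈ filippov U (m τ), φ g ≤ c) :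
    φ (m t) - φ (m s) ≤ c * (t - s) := by
  obtain ⟨g, h1, h2, h3⟩ := hm
  obtain ⟨hi, he⟩ := sub_eq h1 h2 hs hst
  rw [← map_sub, he, ← ContinuousLinearMap.intervalIntegral_comp_comm φ hi]
  have hφ : IntervalIntegrable (fun r => φ (g r)) volume s t :=
    ⟨φ.integrable_comp hi.1, φ.integrable_comp hi.2⟩
  have : ∫ r in s..t, φ (g r) ≤ ∫ _ in s..t, c := by
    refine intervalIntegral.integral_mono_ae_restrict hst hφ (by simp) ?_
    refine (ae_restrict_iff' measurableSet_Icc).2 ?_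
    filter_upwards [h3, Measure.ae_ne volume s, Measure.ae_ne volume t] with r hr hrs hrt hmem
    exact h r ⟨lt_of_le_of_ne hmem.1 (Ne.symm hrs), lt_of_le_of_ne hmem.2 hrt⟩ _
      (hr (hs.trans hmem.1))
  simpa [mul_comm] using this

theorem drift_le (hm : IsSolution U m) (b : B) {c s t : ℝ} (hs : 0 ≤ s) (hst : s ≤ t)
    (h : ∀ τ ∈ Set.Ioo s t, ∀ g ∈ filippov U (m τ), g b ≤ c) :
    m t b - m s b ≤ c * (t - s) :=
  hm.drift (ContinuousLinearMap.proj b) hs hst h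

theorem le_drift (hm : IsSolution U m) (b : B) {c s t : ℝ} (hs : 0 ≤ s) (hst : s ≤ t)
    (h : ∀ τ ∈ Set.Ioo s t, ∀ g ∈ filippov U (m τ), c ≤ g b) :
    c * (t - s) ≤ m t b - m s b := by
  have := hm.drift (-ContinuousLinearMap.proj b) (c := -c) hs hst (by simpa using h)
  simp at this
  linarith

theorem continuousOn_apply (hm : IsSolution U m) (b : B) :
    ContinuousOn (fun t => m t b) (Set.Ici 0) :=
  (continuous_apply b).comp_continuousOn hm.continuousOn

end IsSolution

end General

section General

variable {B : Type} [Fintype B]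

/-- The limit of a convergent solution is an equilibrium. -/
theorem IsSolution.isEquilibrium_of_tendsto {U : (B → ℝ) → (B → ℝ)} {m : ℝ → B → ℝ}
    (hm : IsSolution U m) {p : B → ℝ} (hp : Tendsto m atTop (𝓝 p)) : IsEquilibrium U p := by
  obtain ⟨g, h1, h2, h3⟩ := hm
  refine mem_filippov.2 fun δ hδ Z hZ => ?_
  have hball : ∀ᶠ t in atTop, ∀ s, t ≤ s → m s ∈ Metric.ball p (δ / 2) :=
    eventually_forall_ge_atTop.2 (hp.eventually_mem (Metric.ball_mem_nhds p (half_pos hδ)))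
  have hlim : Tendsto (fun t : ℝ => m (t + 1) - m t) atTop (𝓝 (p - p)) :=
    (hp.comp (tendsto_atTop_add_const_right _ 1 tendsto_id)).sub hp
  rw [sub_self] at hlim
  refine (isClosed_filippovHull U p δ Z).mem_of_tendsto hlim ?_
  filter_upwards [hball, eventually_ge_atTop 0] with t ht h0
  obtain ⟨hi, he⟩ := IsSolution.sub_eq h1 h2 h0 (by linarith : t ≤ t + 1)
  rw [he, intervalIntegral.integral_of_le (by linarith)]
  have hprob : IsProbabilityMeasure (volume.restrict (Set.Ioc t (t + 1))) := ⟨by simp⟩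
  refine (convex_filippovHull U p δ Z).integral_mem (isClosed_filippovHull U p δ Z) ?_ hi.1
  refine (ae_restrict_iff' measurableSet_Ioc).2 ?_
  filter_upwards [h3] with r hr hmem
  have hr' := mem_filippov.1 (hr (h0.trans hmem.1.le)) (δ / 2) (half_pos hδ) Z hZ
  refine filippovHull_mono U (fun y hy => ?_) subset_rfl hr'
  have h4 := ht r hmem.1.le
  rw [Metric.mem_ball] at *
  linarith [dist_triangle y (m r) p]

/-! ### Barriers for continuous functions -/

/-- If `x` does not increase while it is above `u`, then it stays below `u`. -/
theorem le_of_barrier {x : ℝ → ℝ} {s u : ℝ} (hx : ContinuousOn x (Set.Ici s))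
    (h : ∀ a b, s ≤ a → a ≤ b → (∀ τ ∈ Set.Ioo a b, u < x τ) → x b ≤ x a) (hs : x s ≤ u)
    {t : ℝ} (ht : s ≤ t) : x t ≤ u := by
  by_contra! hlt
  have hcont : ContinuousOn x (Set.Icc s t) := hx.mono Set.Icc_subset_Ici_self
  have hK : IsCompact (Set.Icc s t ∩ x ⁻¹' Set.Iic u) :=
    isCompact_Icc.of_isClosed_subset (hcont.preimage_isClosed_of_isClosed isClosed_Icc isClosed_Iic)
      Set.inter_subset_left
  obtain ⟨a, ⟨ha1, ha2⟩, hmax⟩ := hK.exists_isGreatest ⟨s, ⟨le_rfl, ht⟩, hs⟩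
  have : x t ≤ x a := h a t ha1.1 ha1.2 fun τ hτ => by
    by_contra! hle
    exact absurd (hmax ⟨⟨ha1.1.trans hτ.1.le, hτ.2.le⟩, hle⟩) (not_le.2 hτ.1)
  exact absurd (this.trans ha2) (not_le.2 hlt)

/-- If `x` decreases at a positive rate while it is above `u`, then it is eventually below `u`. -/
theorem eventually_le_of_drift {x : ℝ → ℝ} {s u η : ℝ} (hη : 0 < η)
    (hx : ContinuousOn x (Set.Ici s))
    (h : ∀ a b, s ≤ a → a ≤ b → (∀ τ ∈ Set.Ioo a b, u < x τ) → x b - x a ≤ -η * (b - a)) :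
    ∀ᶠ t in atTop, x t ≤ u := by
  have h0 : ∃ a, s ≤ a ∧ x a ≤ u := by
    by_contra! hlt
    have h1 : 0 ≤ (x s - u) / η := div_nonneg (by linarith [hlt s le_rfl]) hη.le
    have h2 := h s (s + (x s - u) / η) le_rfl (by linarith) fun τ hτ => hlt τ hτ.1.le
    have h3 := hlt (s + (x s - u) / η) (by linarith)
    have h4 : -η * (s + (x s - u) / η - s) = -(x s - u) := by field_simp; ring
    linarith
  obtain ⟨a, ha, hau⟩ := h0
  filter_upwards [eventually_ge_atTop a] with t ht
  refine le_of_barrier (hx.mono (Set.Ici_subset_Ici.2 ha)) (fun c d hc hcd hlt => ?_) hau ht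
  have := h c d (ha.trans hc) hcd hlt
  nlinarith

theorem ge_of_barrier {x : ℝ → ℝ} {s u : ℝ} (hx : ContinuousOn x (Set.Ici s))
    (h : ∀ a b, s ≤ a → a ≤ b → (∀ τ ∈ Set.Ioo a b, x τ < u) → x a ≤ x b) (hs : u ≤ x s)
    {t : ℝ} (ht : s ≤ t) : u ≤ x t := by
  have := le_of_barrier (x := fun t => -x t) (u := -u) hx.neg
    (fun a b ha hab hlt => neg_le_neg (h a b ha hab fun τ hτ => neg_lt_neg_iff.1 (hlt τ hτ)))
    (neg_le_neg hs) ht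
  exact neg_le_neg_iff.1 this

theorem eventually_ge_of_drift {x : ℝ → ℝ} {s u η : ℝ} (hη : 0 < η)
    (hx : ContinuousOn x (Set.Ici s))
    (h : ∀ a b, s ≤ a → a ≤ b → (∀ τ ∈ Set.Ioo a b, x τ < u) → η * (b - a) ≤ x b - x a) :
    ∀ᶠ t in atTop, u ≤ x t := by
  have := eventually_le_of_drift (x := fun t => -x t) (u := -u) hη hx.neg
    (fun a b ha hab hlt => by
      have := h a b ha hab fun τ hτ => neg_lt_neg_iff.1 (hlt τ hτ)
      linarith)
  exact this.mono fun t ht => neg_le_neg_iff.1 ht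

/-! ### Existence of solutions -/

/-- Euler's scheme. -/
def euler (f : (B → ℝ) → (B → ℝ)) (h : ℝ) (x₀ : B → ℝ) : ℕ → B → ℝ
  | 0 => x₀
  | k + 1 => euler f h x₀ k + h • f (euler f h x₀ k)

theorem euler_add {B : Type} (f : (B → ℝ) → (B → ℝ)) (h : ℝ) (x₀ : B → ℝ) (k j : ℕ) :
    euler f h x₀ (k + j) =
      euler f h x₀ k + h • ∑ i ∈ Finset.range j, f (euler f h x₀ (k + i)) := by
  induction j with
  | zero => simp
  | succ j ih => 
    rw [← add_assoc, euler, Finset.sum_range_succ, smul_add, ← add_assoc, ← ih]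

theorem dist_euler_add_le {f : (B → ℝ) → (B → ℝ)} {L h : ℝ} (hf : ∀ x, ‖f x‖ ≤ L) (hh : 0 ≤ h)
    (x₀ : B → ℝ) (k j : ℕ) :
    dist (euler f h x₀ (k + j)) (euler f h x₀ k) ≤ L * (h * j) := by
  rw [euler_add, dist_eq_norm, add_sub_cancel_left, norm_smul, Real.norm_of_nonneg hh]
  have : ‖∑ i ∈ Finset.range j, f (euler f h x₀ (k + i))‖ ≤ j * L := by
    simpa using norm_sum_le_of_le (Finset.range j) (fun i _ => hf (euler f h x₀ (k + i)))
  calc h * _ ≤ h * (j * L) := by gcongr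
    _ = _ := by ring

/-- The step function of Euler's scheme with step size `1 / (n + 1)`. -/
def eulerStep (f : (B → ℝ) → (B → ℝ)) (x₀ : B → ℝ) (n : ℕ) (t : ℝ) : B → ℝ :=
  euler f (1 / (n + 1 : ℝ)) x₀ ⌊t * (n + 1)⌋₊

theorem floor_sub_floor_le {a b : ℝ} (h : a ≤ b) :
    ((⌊b⌋₊ - ⌊a⌋₊ : ℕ) : ℝ) ≤ b - a + 1 := by
  rw [Nat.cast_sub (Nat.floor_mono h)]
  rcases le_total b 0 with hb | hb
  · rw [Nat.floor_of_nonpos hb, Nat.floor_of_nonpos (h.trans hb)]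
    simp; linarith
  · linarith [Nat.floor_le hb, Nat.lt_floor_add_one a]

theorem dist_eulerStep_le {f : (B → ℝ) → (B → ℝ)} {L : ℝ} (hL : 0 ≤ L) (hf : ∀ x, ‖f x‖ ≤ L)
    (x₀ : B → ℝ) (n : ℕ) {s t : ℝ} (hst : s ≤ t) :
    dist (eulerStep f x₀ n t) (eulerStep f x₀ n s) ≤ L * (t - s + 1 / (n + 1 : ℝ)) := by
  have hn : (0 : ℝ) < n + 1 := by positivity
  have hle : s * (n + 1 : ℝ) ≤ t * (n + 1) := by gcongr
  have h1 : ⌊t * (n + 1 : ℝ)⌋₊ =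
      ⌊s * (n + 1 : ℝ)⌋₊ + (⌊t * (n + 1 : ℝ)⌋₊ - ⌊s * (n + 1 : ℝ)⌋₊) :=
    (Nat.add_sub_cancel' (Nat.floor_mono hle)).symm
  rw [eulerStep, h1]
  refine (dist_euler_add_le hf (by positivity) _ _ _).trans ?_
  have h2 := floor_sub_floor_le hle
  gcongr
  rw [one_div, inv_mul_le_iff₀ hn]
  calc _ ≤ _ := h2
    _ = _ := by field_simp

theorem exists_eulerStep_limit {f : (B → ℝ) → (B → ℝ)} {L : ℝ} (hL : 0 ≤ L)
    (hf : ∀ x, ‖f x‖ ≤ L) (x₀ : B → ℝ) :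
    ∃ m : ℝ → B → ℝ, ∀ t,
      Tendsto (fun n => eulerStep f x₀ n t) (hyperfilter ℕ : Filter ℕ) (𝓝 (m t)) := by
  have : ∀ t : ℝ, ∃ x, Tendsto (fun n => eulerStep f x₀ n t) (hyperfilter ℕ : Filter ℕ) (𝓝 x) := by
    intro t
    have hK : IsCompact (Metric.closedBall x₀ (L * (2 * |t| + 1))) := isCompact_closedBall _ _
    have hmem : ∀ n, eulerStep f x₀ n t ∈ Metric.closedBall x₀ (L * (2 * |t| + 1)) := by
      intro n
      have hn : (1 : ℝ) ≤ n + 1 := by simp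
      have h0 : eulerStep f x₀ n (-|t|) = x₀ := by
        rw [eulerStep, Nat.floor_of_nonpos (by nlinarith [abs_nonneg t]), euler]
      have h1 := dist_eulerStep_le hL hf x₀ n (neg_abs_le t)
      rw [h0] at h1
      refine h1.trans ?_
      have h2 : 1 / (n + 1 : ℝ) ≤ 1 := (div_le_one (by linarith)).2 hn
      gcongr
      linarith [le_abs_self t]
    obtain ⟨x, -, hx⟩ := hK.ultrafilter_le_nhds
      ((hyperfilter ℕ).map fun n => eulerStep f x₀ n t)
      (by
        rw [le_principal_iff]
        exact Filter.mem_map.2 (Filter.univ_mem' hmem))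
    exact ⟨x, hx⟩
  choose m hm using this
  exact ⟨m, hm⟩

theorem tendsto_one_div_hyperfilter :
    Tendsto (fun n : ℕ => 1 / (n + 1 : ℝ)) (hyperfilter ℕ : Filter ℕ) (𝓝 0) :=
  tendsto_one_div_add_atTop_nhds_zero_nat.mono_left Nat.hyperfilter_le_atTop

theorem dist_eulerStep_limit_le {f : (B → ℝ) → (B → ℝ)} {L : ℝ} (hL : 0 ≤ L)
    (hf : ∀ x, ‖f x‖ ≤ L) {x₀ : B → ℝ} {m : ℝ → B → ℝ}
    (hm : ∀ t, Tendsto (fun n => eulerStep f x₀ n t) (hyperfilter ℕ : Filter ℕ) (𝓝 (m t)))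
    {s t : ℝ} (hst : s ≤ t) : dist (m t) (m s) ≤ L * (t - s) := by
  have h1 := (hm t).dist (hm s)
  have h2 : Tendsto (fun n : ℕ => L * (t - s + 1 / (n + 1 : ℝ))) (hyperfilter ℕ : Filter ℕ)
      (𝓝 (L * (t - s + 0))) := (tendsto_one_div_hyperfilter.const_add _).const_mul _
  rw [add_zero] at h2
  exact le_of_tendsto_of_tendsto' h1 h2 fun n => dist_eulerStep_le hL hf x₀ n hst

theorem slope_eulerStep_limit_mem {V f : (B → ℝ) → (B → ℝ)} {L : ℝ} (hL : 0 ≤ L)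
    (hf : ∀ x, ‖f x‖ ≤ L) (hfV : ∀ x, f x ∈ filippov V x) {x₀ : B → ℝ} {m : ℝ → B → ℝ}
    (hm : ∀ t, Tendsto (fun n => eulerStep f x₀ n t) (hyperfilter ℕ : Filter ℕ) (𝓝 (m t)))
    {s t : ℝ} (hs : 0 ≤ s) (hst : s < t) {δ : ℝ} (hδ : L * (t - s) < δ) {Z : Set (B → ℝ)}
    (hZ : volume Z = 0) : (t - s)⁻¹ • (m t - m s) ∈ filippovHull V (m s) δ Z := by
  have hfloor : ∀ a : ℝ, 0 ≤ a → Tendsto (fun n : ℕ => (⌊a * (n + 1 : ℝ)⌋₊ : ℝ) / (n + 1 : ℝ))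
      (hyperfilter ℕ : Filter ℕ) (𝓝 a) := fun a ha =>
    ((tendsto_nat_floor_mul_div_atTop ha).comp
      (tendsto_atTop_add_const_right _ 1 tendsto_natCast_atTop_atTop)).mono_left
      Nat.hyperfilter_le_atTop
  have hc := (hfloor t (hs.trans hst.le)).sub (hfloor s hs)
  have hlim := (hc.inv₀ (sub_pos.2 hst).ne').smul ((hm t).sub (hm s))
  refine (isClosed_filippovHull _ _ _ _).mem_of_tendsto hlim ?_
  obtain ⟨ρ, hρ0, hρ⟩ : ∃ ρ > 0, L * (t - s) + 3 * ρ < δ :=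
    ⟨(δ - L * (t - s)) / 4, by linarith, by linarith⟩
  have hLlim : Tendsto (fun n : ℕ => L * (1 / (n + 1 : ℝ))) (hyperfilter ℕ : Filter ℕ)
      (𝓝 (L * 0)) := tendsto_one_div_hyperfilter.const_mul _
  rw [mul_zero] at hLlim
  filter_upwards [hc.eventually_const_lt (sub_pos.2 hst), hLlim.eventually_lt_const hρ0,
    (hm s).eventually_mem (Metric.ball_mem_nhds _ hρ0)] with n hn1 hn2 hn3
  have hn : (0 : ℝ) < n + 1 := by positivity
  have hle : s * (n + 1 : ℝ) ≤ t * (n + 1) := by gcongr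
  set a := ⌊s * (n + 1 : ℝ)⌋₊ with ha
  set j := ⌊t * (n + 1 : ℝ)⌋₊ - a with hj
  have hb : ⌊t * (n + 1 : ℝ)⌋₊ = a + j := (Nat.add_sub_cancel' (Nat.floor_mono hle)).symm
  have hjt : (j : ℝ) ≤ (t - s) * (n + 1) + 1 := by
    have := floor_sub_floor_le hle
    linarith
  rw [hb, Nat.cast_add] at hn1 ⊢
  have hj0 : (0 : ℝ) < j := by
    rw [add_div, add_sub_cancel_left] at hn1
    by_contra! h
    exact absurd (div_nonpos_of_nonpos_of_nonneg h hn.le) (not_le.2 hn1)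
  have key : (((a : ℝ) + j) / (n + 1 : ℝ) - a / (n + 1 : ℝ))⁻¹ •
      (eulerStep f x₀ n t - eulerStep f x₀ n s) =
      ∑ i ∈ Finset.range j, (j : ℝ)⁻¹ • f (euler f (1 / (n + 1 : ℝ)) x₀ (a + i)) := by
    rw [eulerStep, eulerStep, hb, euler_add, add_sub_cancel_left, smul_smul, ← Finset.smul_sum]
    have : ((a : ℝ) + j) / (n + 1 : ℝ) - a / (n + 1 : ℝ) = j / (n + 1 : ℝ) := by ring
    rw [this]
    congr 1
    field_simp
  rw [key]
  refine (convex_filippovHull _ _ _ _).sum_mem (fun _ _ => by positivity) ?_ fun i hi => ?_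
  · simp [hj0.ne']
  have hi' : (i : ℝ) ≤ j := by exact_mod_cast (Finset.mem_range.1 hi).le
  refine filippovHull_mono V (fun y hy => ?_) subset_rfl (mem_filippov.1 (hfV _) ρ hρ0 Z hZ)
  rw [Metric.mem_ball] at hy hn3 ⊢
  have h1 := dist_euler_add_le hf (by positivity : (0 : ℝ) ≤ 1 / (n + 1 : ℝ)) x₀ a i
  have h2 : L * (1 / (n + 1 : ℝ) * i) ≤ L * (t - s) + L * (1 / (n + 1 : ℝ)) := by
    rw [← mul_add]
    gcongr
    rw [one_div, inv_mul_le_iff₀ hn]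
    calc (i : ℝ) ≤ (t - s) * (n + 1) + 1 := hi'.trans hjt
      _ = _ := by field_simp
  have h3 := dist_triangle4 y (euler f (1 / (n + 1 : ℝ)) x₀ (a + i))
    (euler f (1 / (n + 1 : ℝ)) x₀ a) (m s)
  have h4 : dist (euler f (1 / (n + 1 : ℝ)) x₀ a) (m s) < ρ := hn3
  linarith

theorem LipschitzWith.integral_deriv_eq_sub {m : ℝ → B → ℝ} {K : NNReal} (hm : LipschitzWith K m)
    (s t : ℝ) : IntervalIntegrable (deriv m) volume s t ∧ ∫ r in s..t, deriv m r = m t - m s := by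
  have hmeas : AEStronglyMeasurable (deriv m) (volume.restrict (Set.uIoc s t)) :=
    (stronglyMeasurable_deriv m).aestronglyMeasurable
  have hint : IntervalIntegrable (deriv m) volume s t :=
    (intervalIntegrable_const (c := (K : ℝ))).mono_fun hmeas
      (Eventually.of_forall fun r => by
        simpa using norm_deriv_le_of_lipschitz hm)
  refine ⟨hint, funext fun b => ?_⟩
  have hb : LipschitzWith K fun t => m t b := by
    have := (LipschitzWith.eval (α := fun _ : B => ℝ) b).comp hm
    rwa [one_mul] at this
  have h1 := (hb.lipschitzOnWith (s := Set.uIcc s t)).absolutelyContinuousOnInterval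
  have h2 := h1.integral_deriv_eq_sub
  rw [Pi.sub_apply, ← h2]
  have h3 := ContinuousLinearMap.intervalIntegral_comp_comm
    (ContinuousLinearMap.proj (R := ℝ) (φ := fun _ : B => ℝ) b) hint
  simp only [ContinuousLinearMap.proj_apply] at h3
  rw [← h3]
  refine intervalIntegral.integral_congr_ae ?_
  filter_upwards [hm.ae_differentiableAt_real] with r hr _
  exact ((hasDerivAt_pi.1 hr.hasDerivAt) b).deriv.symm

/-- A bounded vector field has a Filippov solution from every initial condition. -/
theorem exists_isSolution {V : (B → ℝ) → (B → ℝ)} {L : ℝ} (hV : ∀ x, ‖V x‖ ≤ L) (x₀ : B → ℝ) :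
    ∃ m, IsSolution V m ∧ m 0 = x₀ := by
  have hL : 0 ≤ L := (norm_nonneg _).trans (hV 0)
  choose f hfV using filippov_nonempty hV
  have hf : ∀ x, ‖f x‖ ≤ L := fun x => filippov_norm_le hV (hfV x)
  obtain ⟨m, hm⟩ := exists_eulerStep_limit hL hf x₀
  have hlip : LipschitzWith L.toNNReal m := by
    refine LipschitzWith.of_dist_le_mul fun t s => ?_
    rw [Real.coe_toNNReal _ hL, Real.dist_eq]
    rcases le_total s t with h | h
    · rw [abs_of_nonneg (sub_nonneg.2 h)]
      exact dist_eulerStep_limit_le hL hf hm h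
    · rw [abs_sub_comm, abs_of_nonneg (sub_nonneg.2 h), dist_comm]
      exact dist_eulerStep_limit_le hL hf hm h
  refine ⟨m, ⟨deriv m, fun t _ => (hlip.integral_deriv_eq_sub 0 t).1, fun t _ => ?_, ?_⟩, ?_⟩
  · rw [(hlip.integral_deriv_eq_sub 0 t).2, add_sub_cancel]
  · filter_upwards [hlip.ae_differentiableAt_real] with t ht h0
    refine mem_filippov.2 fun δ hδ Z hZ => ?_
    have hlim : Tendsto (slope m t) (𝓝[>] t) (𝓝 (deriv m t)) :=
      (hasDerivAt_iff_tendsto_slope.1 ht.hasDerivAt).mono_left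
        (nhdsWithin_mono _ fun s hs => ne_of_gt hs)
    refine (isClosed_filippovHull _ _ _ _).mem_of_tendsto hlim ?_
    have hsmall : ∀ᶠ s in 𝓝[>] t, L * (s - t) < δ := by
      have : Tendsto (fun s => L * (s - t)) (𝓝[>] t) (𝓝 (L * (t - t))) :=
        ((continuous_const.mul (continuous_id.sub continuous_const)).tendsto t).mono_left
          nhdsWithin_le_nhds
      rw [sub_self, mul_zero] at this
      exact this.eventually_lt_const hδ
    filter_upwards [hsmall, self_mem_nhdsWithin] with s hs hts
    exact slope_eulerStep_limit_mem hL hf hfV hm h0 hts hs hZ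
  · refine tendsto_nhds_unique (hm 0) ?_
    simp [eulerStep, euler]

end General

/-! ### Auctions -/

namespace ROSSystem

variable {B I : Type} (S : ROSSystem B I)

/-- The highest competing bid. -/
def price (m : B → ℝ) (i : B) (j : I) : ℝ := ⨆ s : {s : B // s ≠ i}, S.bid m s j

/-- The utility of a bidder from a single item. -/
def itemUtility (m : B → ℝ) (i : B) (j : I) : ℝ := S.alloc m i j * (S.v i j - S.price m i j)

theorem utility_eq_sum [Fintype I] (m : B → ℝ) (i : B) :
    S.utility m i = ∑ j, S.itemUtility m i j := by
  refine Finset.sum_congr rfl fun j _ => ?_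
  rw [itemUtility, pay, price]
  ring

variable {S} {m : B → ℝ} {i : B} {j : I}

theorem bid_le_price [Fintype B] {s : B} (h : s ≠ i) : S.bid m s j ≤ S.price m i j :=
  le_ciSup (f := fun s : {s : B // s ≠ i} => S.bid m s j) (Set.finite_range _).bddAbove ⟨s, h⟩

theorem price_le [Nonempty {s : B // s ≠ i}] {c : ℝ} (h : ∀ s, s ≠ i → S.bid m s j ≤ c) :
    S.price m i j ≤ c :=
  ciSup_le fun s => h s s.2

theorem alloc_nonneg : 0 ≤ S.alloc m i j := by
  rw [alloc]
  split_ifs <;> positivity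

theorem alloc_le_one [Fintype B] : S.alloc m i j ≤ 1 := by
  rw [alloc]
  split_ifs with h
  · have : 0 < (S.winners m j).ncard := (Set.ncard_pos (Set.toFinite _)).2 ⟨i, h⟩
    rw [div_le_one (by exact_mod_cast this)]
    exact_mod_cast this
  · exact zero_le_one

theorem alloc_eq_zero {s : B} (h : S.bid m i j < S.bid m s j) : S.alloc m i j = 0 :=
  if_neg fun hi => absurd (hi s) (not_le.2 h)

theorem alloc_eq_one (h : ∀ s, s ≠ i → S.bid m s j < S.bid m i j) : S.alloc m i j = 1 := by
  have hw : S.winners m j = {i} := by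
    ext s
    simp only [winners, Set.mem_ofPred_eq, Set.mem_singleton_iff]
    constructor
    · intro hs
      by_contra hne
      exact absurd (hs i) (not_le.2 (h s hne))
    · rintro rfl t
      rcases eq_or_ne t s with rfl | hne
      · exact le_rfl
      · exact (h t hne).le
  rw [alloc, hw]
  simp

theorem alloc_eq_one_of_price_lt [Fintype B] (h : S.price m i j < S.bid m i j) : S.alloc m i j = 1 :=
  alloc_eq_one fun _ hs => (bid_le_price hs).trans_lt h

theorem inv_card_le_alloc [Fintype B] (h : ∀ s, S.bid m s j ≤ S.bid m i j) :
    1 / (Fintype.card B : ℝ) ≤ S.alloc m i j := by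
  have hi : i ∈ S.winners m j := h
  rw [alloc, if_pos hi]
  have h0 : 0 < (S.winners m j).ncard := (Set.ncard_pos (Set.toFinite _)).2 ⟨i, hi⟩
  have h1 : (S.winners m j).ncard ≤ Fintype.card B := by
    rw [← Nat.card_eq_fintype_card, ← Set.ncard_univ]
    exact Set.ncard_le_ncard (Set.subset_univ _)
  exact one_div_le_one_div_of_le (by exact_mod_cast h0) (by exact_mod_cast h1)

theorem itemUtility_eq_zero_of_lt {s : B} (h : S.bid m i j < S.bid m s j) :
    S.itemUtility m i j = 0 := by
  rw [itemUtility, alloc_eq_zero h, zero_mul]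

theorem itemUtility_eq_of_price_lt [Fintype B] (h : S.price m i j < S.bid m i j) :
    S.itemUtility m i j = S.v i j - S.price m i j := by
  rw [itemUtility, alloc_eq_one_of_price_lt h, one_mul]

theorem itemUtility_le_max [Fintype B] : S.itemUtility m i j ≤ max 0 (S.v i j - S.price m i j) := by
  have h0 := S.alloc_nonneg (m := m) (i := i) (j := j)
  have h1 := S.alloc_le_one (m := m) (i := i) (j := j)
  rw [itemUtility]
  rcases le_total 0 (S.v i j - S.price m i j) with h | h
  · exact le_max_of_le_right (mul_le_of_le_one_left h h1)
  · exact le_max_of_le_left (mul_nonpos_of_nonneg_of_nonpos h0 h)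

theorem min_le_itemUtility [Fintype B] : min 0 (S.v i j - S.price m i j) ≤ S.itemUtility m i j := by
  have h0 := S.alloc_nonneg (m := m) (i := i) (j := j)
  have h1 := S.alloc_le_one (m := m) (i := i) (j := j)
  rw [itemUtility]
  rcases le_total 0 (S.v i j - S.price m i j) with h | h
  · exact min_le_of_left_le (mul_nonneg h0 h)
  · refine min_le_of_right_le ?_
    nlinarith

theorem price_nonneg [Fintype B] [Nonempty {s : B // s ≠ i}] (hm : ∀ b, 0 ≤ m b) : 0 ≤ S.price m i j := by
  obtain ⟨s, hs⟩ := ‹Nonempty {s : B // s ≠ i}›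
  exact (mul_nonneg (hm s) (S.nonneg s j)).trans (bid_le_price hs)

theorem itemUtility_le_value [Fintype B] [Nonempty {s : B // s ≠ i}] (hm : ∀ b, 0 ≤ m b) :
    S.itemUtility m i j ≤ S.v i j :=
  itemUtility_le_max.trans
    (max_le (S.nonneg i j) (by linarith [price_nonneg (S := S) (i := i) (j := j) hm]))

theorem itemUtility_le_of_bid_le [Fintype B] {s : B} (hs : s ≠ i) {c : ℝ} (h : S.v i j - S.bid m s j ≤ c)
    (hc : 0 ≤ c) : S.itemUtility m i j ≤ c :=
  itemUtility_le_max.trans (max_le hc (by linarith [bid_le_price (S := S) (m := m) (j := j) hs]))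

/-- A bidder who wins an item pays at most the own bid. -/
theorem price_le_bid [Nonempty {s : B // s ≠ i}] (h : S.alloc m i j ≠ 0) :
    S.price m i j ≤ S.bid m i j := by
  refine price_le fun s _ => ?_
  by_contra! hlt
  exact h (alloc_eq_zero hlt)

theorem itemUtility_eq_zero [Fintype B] [Nonempty {s : B // s ≠ i}] (hm : ∀ b, 0 ≤ m b) (hv : S.v i j = 0) :
    S.itemUtility m i j = 0 := by
  by_cases h : S.alloc m i j = 0
  · rw [itemUtility, h, zero_mul]
  · have h1 := price_le_bid h
    rw [bid, hv, mul_zero] at h1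
    rw [itemUtility, hv, le_antisymm h1 (price_nonneg hm), sub_zero, mul_zero]

/-- Bidders whose multiplier is at most `1` have no losses. -/
theorem utility_nonneg [Fintype I] [Nonempty {s : B // s ≠ i}] (hi : m i ≤ 1) :
    0 ≤ S.utility m i := by
  rw [utility_eq_sum]
  refine Finset.sum_nonneg fun j _ => ?_
  by_cases h : S.alloc m i j = 0
  · rw [itemUtility, h, zero_mul]
  · refine mul_nonneg alloc_nonneg (sub_nonneg.2 ((price_le_bid h).trans ?_))
    exact mul_le_of_le_one_left (S.nonneg i j) hi

end ROSSystem

/-! ### Utilities in the system of a NOR network -/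

instance GateBidder.nonempty_ne {N : ℕ} (b : GateBidder N) :
    Nonempty {s : GateBidder N // s ≠ b} := by
  rcases b with k | ⟨k, r, s⟩
  · exact ⟨⟨.inr (k, .H, 0), by simp⟩⟩
  · exact ⟨⟨.inl k, by simp⟩⟩

theorem ItemKind.sum_eq (f : ItemKind → ℝ) :
    ∑ a, f a = f .L + f (.reserved .H) + f (.reserved .ceiling) + f (.reserved .E)
      + f (.aux .H) + f (.aux .ceiling) + f (.aux .E) + f .F := by
  have : (Finset.univ : Finset ItemKind) =
      {.L, .reserved .H, .reserved .ceiling, .reserved .E, .aux .H, .aux .ceiling, .aux .E, .F} := by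
    decide
  rw [this]
  simp [add_assoc]

/-- The larger one of the multipliers of the two auxiliary bidders for an item with a reserve
price. -/
def auxMax {N : ℕ} (x : GateBidder N → ℝ) (k : Fin N) (r : ReservedItem) : ℝ :=
  max (x (.inr (k, r, 0))) (x (.inr (k, r, 1)))

theorem le_auxMax {N : ℕ} (x : GateBidder N → ℝ) (k : Fin N) (r : ReservedItem) (s : Fin 2) :
    x (.inr (k, r, s)) ≤ auxMax x k r := by
  fin_cases s
  · exact le_max_left _ _
  · exact le_max_right _ _

theorem exists_eq_auxMax {N : ℕ} (x : GateBidder N → ℝ) (k : Fin N) (r : ReservedItem) :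
    ∃ s, x (.inr (k, r, s)) = auxMax x k r := by
  rcases max_choice (x (.inr (k, r, 0))) (x (.inr (k, r, 1))) with h | h
  · exact ⟨0, h.symm⟩
  · exact ⟨1, h.symm⟩

theorem continuous_auxMax {N : ℕ} (k : Fin N) (r : ReservedItem) :
    Continuous fun x : GateBidder N → ℝ => auxMax x k r :=
  (continuous_apply _).max (continuous_apply _)

namespace GateParams

open ROSSystem

variable {N : ℕ} {D : NORNetwork N} (P : GateParams D)

theorem one_lt_low : 1 < P.low := P.one_le_floor.trans_lt P.floor_lt_low

theorem one_lt_threshold : 1 < P.threshold := P.one_lt_low.trans P.low_lt_threshold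

theorem one_lt_high : 1 < P.high := P.one_lt_threshold.trans P.threshold_lt_high

theorem T_pos : 0 < P.T := mul_pos (zero_lt_one.trans P.one_lt_threshold) P.V_pos

theorem T_lt_C : P.T < P.C := by
  have := P.T_pos
  have h : P.C = P.low * P.T := by rw [C, T, mul_assoc]
  rw [h]
  nlinarith [P.one_lt_low]

theorem C_pos : 0 < P.C := P.T_pos.trans P.T_lt_C

theorem M_pos (i : Fin N) : 0 < P.M i := by
  have h5 := P.lt_M i
  have h6 : 0 ≤ P.V * ((Finset.univ.filter fun k => i ∈ D.inputs k).card : ℝ) :=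
    mul_nonneg P.V_pos.le (Nat.cast_nonneg _)
  have h7 : 0 < (P.high - 1) * P.M i := by
    have e1 : P.threshold * P.V = P.T := rfl
    have e2 : P.low * P.threshold * P.V = P.C := rfl
    rw [e1, e2] at h5
    linarith [P.T_pos, P.C_pos, P.one_le_floor]
  exact pos_of_mul_pos_right h7 (by linarith [P.one_lt_high])

theorem reservePrice_pos (i : Fin N) (r : ReservedItem) : 0 < P.reservePrice i r := by
  rcases r with _ | _ | _
  · exact P.C_pos
  · exact mul_pos (zero_lt_one.trans P.one_lt_high) (P.M_pos i)
  · exact zero_lt_one.trans_le P.one_le_floor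

variable {P} {x : GateBidder N → ℝ}

theorem price_reserved (hx : ∀ b, 0 < x b) (k : Fin N) (r : ReservedItem) :
    P.system.price x (.inl k) (k, .reserved r) = P.reservePrice k r * auxMax x k r := by
  have hR := P.reservePrice_pos k r
  have hA : 0 < auxMax x k r := (hx _).trans_le (le_auxMax x k r 0)
  refine le_antisymm (price_le ?_) ?_
  · rintro (i | ⟨i, r', s⟩) hne
    · have hik : i ≠ k := fun h => hne (by rw [h])
      have : P.system.bid x (.inl i) (k, .reserved r) = 0 := by
        simp [bid, system, value, hik]
      rw [this]
      positivity
    · by_cases h : i = k ∧ r' = r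
      · obtain ⟨rfl, rfl⟩ := h
        have : P.system.bid x (.inr (i, r', s)) (i, .reserved r') =
            P.reservePrice i r' * x (.inr (i, r', s)) := by
          simp [bid, system, value, mul_comm]
        rw [this]
        gcongr
        exact le_auxMax x i r' s
      · have : P.system.bid x (.inr (i, r', s)) (k, .reserved r) = 0 := by
          simp [bid, system, value, h]
        rw [this]
        positivity
  · obtain ⟨s, hs⟩ := exists_eq_auxMax x k r
    have : P.system.bid x (.inr (k, r, s)) (k, .reserved r) =
        P.reservePrice k r * auxMax x k r := by
      simp [bid, system, value, mul_comm, hs]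
    rw [← this]
    exact bid_le_price (by simp)

theorem itemUtility_F (hx : ∀ b, 0 < x b) (k : Fin N) :
    P.system.itemUtility x (.inl k) (k, .F) = P.floor - 1 := by
  have hv : P.system.v (.inl k) (k, .F) = P.floor - 1 := by simp [system, value]
  rcases P.one_le_floor.eq_or_lt with h | h
  · rw [itemUtility_eq_zero (fun b => (hx b).le) (by rw [hv, ← h, sub_self]), ← h, sub_self]
  · have hp : P.system.price x (.inl k) (k, .F) = 0 := by
      refine le_antisymm (price_le ?_) (price_nonneg fun b => (hx b).le)
      rintro (i | ⟨i, r', s⟩) hne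
      · have hik : i ≠ k := fun h => hne (by rw [h])
        simp [bid, system, value, hik]
      · simp [bid, system, value]
    rw [itemUtility_eq_of_price_lt, hp, hv, sub_zero]
    rw [hp, bid, hv]
    exact mul_pos (hx _) (by linarith)

theorem utility_inl (hD : ∀ k, k ∉ D.inputs k) (hx : ∀ b, 0 < x b) (k : Fin N) :
    P.system.utility x (.inl k) =
      P.system.itemUtility x (.inl k) (k, .L) + (P.floor - 1)
      + P.system.itemUtility x (.inl k) (k, .reserved .H)
      + P.system.itemUtility x (.inl k) (k, .reserved .ceiling)
      + P.system.itemUtility x (.inl k) (k, .reserved .E)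
      + ∑ l ∈ Finset.univ.filter (fun l => k ∈ D.inputs l),
        P.system.itemUtility x (.inl k) (l, .L) := by
  have hx' : ∀ b, 0 ≤ x b := fun b => (hx b).le
  rw [utility_eq_sum, Fintype.sum_prod_type]
  have key : ∀ l : Fin N, ∑ a, P.system.itemUtility x (.inl k) (l, a) =
      (if l = k then P.system.itemUtility x (.inl k) (k, .L) + (P.floor - 1)
        + P.system.itemUtility x (.inl k) (k, .reserved .H)
        + P.system.itemUtility x (.inl k) (k, .reserved .ceiling)
        + P.system.itemUtility x (.inl k) (k, .reserved .E) else 0)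
      + if k ∈ D.inputs l then P.system.itemUtility x (.inl k) (l, .L) else 0 := by
    intro l
    have haux : ∀ r, P.system.itemUtility x (.inl k) (l, .aux r) = 0 := fun r =>
      itemUtility_eq_zero hx' rfl
    rw [ItemKind.sum_eq, haux, haux, haux]
    by_cases hlk : l = k
    · subst hlk
      rw [if_pos rfl, if_neg (hD l), itemUtility_F hx]
      ring
    · have hkl : k ≠ l := Ne.symm hlk
      rw [if_neg hlk]
      have hres : ∀ r, P.system.itemUtility x (.inl k) (l, .reserved r) = 0 := fun r =>
        itemUtility_eq_zero hx' (by simp [system, value, hkl])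
      have hF : P.system.itemUtility x (.inl k) (l, .F) = 0 :=
        itemUtility_eq_zero hx' (by simp [system, value, hkl])
      rw [hres, hres, hres, hF]
      split_ifs with h
      · ring
      · have : P.system.itemUtility x (.inl k) (l, .L) = 0 :=
          itemUtility_eq_zero hx' (by simp [system, value, hkl, h])
        rw [this]
        ring
  rw [Finset.sum_congr rfl fun l _ => key l, Finset.sum_add_distrib, Finset.sum_ite_eq',
    if_pos (Finset.mem_univ k), Finset.sum_filter]

theorem utility_inr (hx : ∀ b, 0 < x b) (k : Fin N) (r : ReservedItem) (s : Fin 2) :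
    P.system.utility x (.inr (k, r, s)) =
      P.system.itemUtility x (.inr (k, r, s)) (k, .reserved r)
      + P.system.itemUtility x (.inr (k, r, s)) (k, .aux r) := by
  classical
  have hx' : ∀ b, 0 ≤ x b := fun b => (hx b).le
  rw [utility_eq_sum, ← Finset.sum_subset (Finset.subset_univ
    {((k, .reserved r) : GateItem N), (k, .aux r)}), Finset.sum_pair (by simp)]
  rintro ⟨l, a⟩ - hnot
  refine itemUtility_eq_zero hx' ?_
  rcases a with _ | r' | r' | _
  · rfl
  · have : ¬ (k = l ∧ r = r') := by
      rintro ⟨rfl, rfl⟩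
      simp at hnot
    simp [system, value, this]
  · have : ¬ (k = l ∧ r = r') := by
      rintro ⟨rfl, rfl⟩
      simp at hnot
    simp [system, value, this]
  · rfl

end GateParams

namespace GateParams

open ROSSystem

variable {N : ℕ} {D : NORNetwork N} {P : GateParams D} {x : GateBidder N → ℝ} {k : Fin N}

/-! ### Bounds for single items -/

theorem itemUtility_reserved_eq_zero {r : ReservedItem}
    (h : x (.inl k) * P.reservedValue k r < P.reservePrice k r * auxMax x k r) :
    P.system.itemUtility x (.inl k) (k, .reserved r) = 0 := by
  obtain ⟨s, hs⟩ := exists_eq_auxMax x k r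
  refine itemUtility_eq_zero_of_lt (s := .inr (k, r, s)) ?_
  have h1 : P.system.bid x (.inr (k, r, s)) (k, .reserved r) =
      P.reservePrice k r * auxMax x k r := by
    simp [bid, system, value, mul_comm, hs]
  have h2 : P.system.bid x (.inl k) (k, .reserved r) = x (.inl k) * P.reservedValue k r := by
    simp [bid, system, value]
  rwa [h1, h2]

theorem itemUtility_reserved_eq (hx : ∀ b, 0 < x b) {r : ReservedItem}
    (h : P.reservePrice k r * auxMax x k r < x (.inl k) * P.reservedValue k r) :
    P.system.itemUtility x (.inl k) (k, .reserved r) =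
      P.reservedValue k r - P.reservePrice k r * auxMax x k r := by
  have hp := price_reserved (P := P) hx k r
  have h2 : P.system.bid x (.inl k) (k, .reserved r) = x (.inl k) * P.reservedValue k r := by
    simp [bid, system, value]
  have h3 : P.system.v (.inl k) (k, .reserved r) = P.reservedValue k r := by
    simp [system, value]
  rw [itemUtility_eq_of_price_lt (by rwa [hp, h2]), hp, h3]

theorem itemUtility_reserved_le (hx : ∀ b, 0 < x b) (r : ReservedItem) :
    P.system.itemUtility x (.inl k) (k, .reserved r) ≤
      max 0 (P.reservedValue k r - P.reservePrice k r * auxMax x k r) := by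
  have h3 : P.system.v (.inl k) (k, .reserved r) = P.reservedValue k r := by
    simp [system, value]
  rw [← price_reserved hx k r, ← h3]
  exact itemUtility_le_max

theorem le_itemUtility_reserved (hx : ∀ b, 0 < x b) (r : ReservedItem) :
    min 0 (P.reservedValue k r - P.reservePrice k r * auxMax x k r) ≤
      P.system.itemUtility x (.inl k) (k, .reserved r) := by
  have h3 : P.system.v (.inl k) (k, .reserved r) = P.reservedValue k r := by
    simp [system, value]
  rw [← price_reserved hx k r, ← h3]
  exact min_le_itemUtility

theorem v_L_self : P.system.v (.inl k) (k, .L) = P.C := by simp [system, value]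

theorem v_L_input (hD : ∀ k, k ∉ D.inputs k) {j : Fin N} (hj : j ∈ D.inputs k) :
    P.system.v (.inl j) (k, .L) = P.V := by
  have : j ≠ k := fun h => hD k (h ▸ hj)
  simp [system, value, this, hj]

theorem itemUtility_L_le (hD : ∀ k, k ∉ D.inputs k) {j : Fin N} (hj : j ∈ D.inputs k) {w : ℝ}
    (hw : w ≤ x (.inl j)) (hwC : w * P.V ≤ P.C) :
    P.system.itemUtility x (.inl k) (k, .L) ≤ P.C - w * P.V := by
  have hne : (.inl j : GateBidder N) ≠ .inl k := fun h => hD k (Sum.inl.inj h ▸ hj)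
  refine itemUtility_le_of_bid_le hne ?_ (by linarith)
  rw [v_L_self, bid, v_L_input hD hj]
  nlinarith [P.V_pos]

theorem le_itemUtility_L {w : ℝ} (hw0 : 0 ≤ w)
    (hw : ∀ j ∈ D.inputs k, x (.inl j) ≤ w) (hwC : w * P.V < x (.inl k) * P.C) :
    P.C - w * P.V ≤ P.system.itemUtility x (.inl k) (k, .L) := by
  have hp : P.system.price x (.inl k) (k, .L) ≤ w * P.V := by
    refine price_le ?_
    rintro (i | ⟨i, r', s⟩) hne
    · have hik : i ≠ k := fun h => hne (by rw [h])
      by_cases hi : i ∈ D.inputs k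
      · have : P.system.v (.inl i) (k, .L) = P.V := by simp [system, value, hik, hi]
        rw [bid, this]
        exact mul_le_mul_of_nonneg_right (hw i hi) P.V_pos.le
      · have : P.system.v (.inl i) (k, .L) = 0 := by simp [system, value, hik, hi]
        rw [bid, this, mul_zero]
        exact mul_nonneg hw0 P.V_pos.le
    · have : P.system.v (.inr (i, r', s)) (k, .L) = 0 := rfl
      rw [bid, this, mul_zero]
      exact mul_nonneg hw0 P.V_pos.le
  rw [itemUtility_eq_of_price_lt (by rw [bid, v_L_self]; linarith), v_L_self]
  linarith

theorem itemUtility_L_input_nonpos (hD : ∀ k, k ∉ D.inputs k) {l : Fin N} (hl : k ∈ D.inputs l)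
    (h : P.V ≤ x (.inl l) * P.C) : P.system.itemUtility x (.inl k) (l, .L) ≤ 0 := by
  have hne : (.inl l : GateBidder N) ≠ .inl k := fun h => hD l (Sum.inl.inj h ▸ hl)
  refine itemUtility_le_of_bid_le hne ?_ le_rfl
  rw [v_L_input hD hl, bid, v_L_self]
  linarith

theorem itemUtility_L_input_eq_zero (hD : ∀ k, k ∉ D.inputs k) {l : Fin N}
    (hl : k ∈ D.inputs l) (h : x (.inl k) * P.V < x (.inl l) * P.C) :
    P.system.itemUtility x (.inl k) (l, .L) = 0 := by
  refine itemUtility_eq_zero_of_lt (s := .inl l) ?_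
  rwa [bid, bid, v_L_self, v_L_input hD hl]

/-! ### Bounds for the utilities of the variable bidders -/

variable (P) in
/-- By how much the value of the ceiling item exceeds what the bidder can gain elsewhere. -/
def slack (k : Fin N) : ℝ :=
  (P.high - 1) * P.M k - (P.C + P.T + 1 + (P.floor - 1)
    + P.V * ((Finset.univ.filter fun l => k ∈ D.inputs l).card : ℝ))

theorem slack_pos (k : Fin N) : 0 < P.slack k := sub_pos.2 (P.lt_M k)

theorem utility_le_of_ceiling_lt (hD : ∀ k, k ∉ D.inputs k) (hx : ∀ b, 0 < x b)
    (h : P.high * auxMax x k .ceiling < x (.inl k)) :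
    P.system.utility x (.inl k) ≤
      P.high * P.M k * (1 - auxMax x k .ceiling) - P.slack k := by
  have hx' : ∀ b, 0 ≤ x b := fun b => (hx b).le
  have hM := P.M_pos k
  have h1 : P.system.itemUtility x (.inl k) (k, .L) ≤ P.C :=
    (itemUtility_le_value hx').trans_eq v_L_self
  have h2 : P.system.itemUtility x (.inl k) (k, .reserved .H) ≤ P.T :=
    (itemUtility_le_value hx').trans_eq (by simp [system, value, reservedValue])
  have h3 : P.system.itemUtility x (.inl k) (k, .reserved .E) ≤ 1 :=
    (itemUtility_le_value hx').trans_eq (by simp [system, value, reservedValue])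
  have h4 : P.system.itemUtility x (.inl k) (k, .reserved .ceiling) =
      P.M k - P.high * P.M k * auxMax x k .ceiling := by
    refine itemUtility_reserved_eq hx ?_
    simp only [reservePrice, reservedValue]
    nlinarith
  have h5 : ∑ l ∈ Finset.univ.filter (fun l => k ∈ D.inputs l),
      P.system.itemUtility x (.inl k) (l, .L) ≤
      ((Finset.univ.filter fun l => k ∈ D.inputs l).card : ℝ) * P.V := by
    rw [← nsmul_eq_mul]
    refine Finset.sum_le_card_nsmul _ _ _ fun l hl => ?_
    exact (itemUtility_le_value hx').trans_eq (v_L_input hD (Finset.mem_filter.1 hl).2)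
  rw [utility_inl hD hx, h4, slack]
  linarith

variable (P) in
/-- A margin of error for multipliers within which the gates work. -/
structure IsTolerance (ε : ℝ) : Prop where
  pos : 0 < ε
  lt_one : ε < 1
  high_lt : P.high * (1 + ε) * P.V < (1 - ε) * P.C
  one_lt : 1 < P.high * (1 - ε)
  floor_lt : P.floor * (1 + ε) < P.low
  turn_low : P.T - (P.threshold + P.high) / 2 * P.V + (P.C + P.floor) * ε < 0
  turn_high : 0 < P.T - (P.low + P.threshold) / 2 * P.V - (P.C + P.floor) * ε
  above_low : 0 < P.C * (1 - ε) - (P.high + P.low * P.threshold) / 2 * P.V - P.floor * ε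

variable (P) in
theorem exists_isTolerance : ∃ ε, P.IsTolerance ε := by
  have hV := P.V_pos
  have h1 := P.one_lt_high
  have h2 := P.threshold_lt_high
  have h3 := P.low_lt_threshold
  have h4 := P.high_lt
  have ev : ∀ {f g : ℝ → ℝ}, Continuous f → Continuous g → f 0 < g 0 → ∀ᶠ ε in 𝓝[>] 0, f ε < g ε :=
    fun hf hg h => ((hf.tendsto 0).eventually_lt (hg.tendsto 0) h).filter_mono nhdsWithin_le_nhds
  have e1 : ∀ᶠ ε in 𝓝[>] (0 : ℝ), ε < 1 := ev continuous_id continuous_const one_pos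
  have e2 : ∀ᶠ ε in 𝓝[>] (0 : ℝ), P.high * (1 + ε) * P.V < (1 - ε) * P.C :=
    ev (by fun_prop) (by fun_prop) (by simp only [C]; nlinarith)
  have e3 : ∀ᶠ ε in 𝓝[>] (0 : ℝ), 1 < P.high * (1 - ε) :=
    ev (by fun_prop) (by fun_prop) (by linarith)
  have e4 : ∀ᶠ ε in 𝓝[>] (0 : ℝ), P.floor * (1 + ε) < P.low :=
    ev (by fun_prop) (by fun_prop) (by linarith [P.floor_lt_low])
  have e5 : ∀ᶠ ε in 𝓝[>] (0 : ℝ),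
      P.T - (P.threshold + P.high) / 2 * P.V + (P.C + P.floor) * ε < 0 :=
    ev (by fun_prop) (by fun_prop) (by simp only [T]; nlinarith)
  have e6 : ∀ᶠ ε in 𝓝[>] (0 : ℝ),
      0 < P.T - (P.low + P.threshold) / 2 * P.V - (P.C + P.floor) * ε :=
    ev (by fun_prop) (by fun_prop) (by simp only [T]; nlinarith)
  have e7 : ∀ᶠ ε in 𝓝[>] (0 : ℝ),
      0 < P.C * (1 - ε) - (P.high + P.low * P.threshold) / 2 * P.V - P.floor * ε :=
    ev (by fun_prop) (by fun_prop) (by simp only [C]; nlinarith)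
  obtain ⟨ε, h0, h1, h2, h3, h4, h5, h6, h7⟩ := (eventually_mem_nhdsWithin.and
    (e1.and (e2.and (e3.and (e4.and (e5.and (e6.and e7))))))).exists
  exact ⟨ε, h0, h1, h2, h3, h4, h5, h6, h7⟩

variable {ε : ℝ}

/-- A gate with a true input moves down to `low`. -/
theorem utility_le_of_input (hD : ∀ k, k ∉ D.inputs k) (hε : P.IsTolerance ε)
    (hx : ∀ b, 1 - ε < x b) {j : Fin N} (hj : j ∈ D.inputs k)
    (hjx : (P.threshold + P.high) / 2 ≤ x (.inl j))
    (hH : P.low * auxMax x k .H < x (.inl k)) (hE : P.floor * auxMax x k .E < x (.inl k)) :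
    P.system.utility x (.inl k) ≤
      P.T - (P.threshold + P.high) / 2 * P.V + (P.C + P.floor) * ε := by
  have hx0 : ∀ b, 0 < x b := fun b => by linarith [hx b, hε.lt_one]
  have hV := P.V_pos
  have hA : ∀ r, 1 - ε < auxMax x k r := fun r => (hx _).trans_le (le_auxMax x k r 0)
  have hε1 := hε.high_lt
  have h1ε := hε.pos
  have h1 : P.system.itemUtility x (.inl k) (k, .L) ≤
      P.C - (P.threshold + P.high) / 2 * P.V := by
    refine itemUtility_L_le hD hj hjx ?_
    have : P.high * P.V < P.C := by rw [C]; nlinarith [P.high_lt]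
    nlinarith [P.threshold_lt_high]
  have h2 : P.system.itemUtility x (.inl k) (k, .reserved .H) = P.T - P.C * auxMax x k .H := by
    refine itemUtility_reserved_eq hx0 ?_
    simp only [reservePrice, reservedValue]
    have : P.C = P.low * P.T := by rw [C, T, mul_assoc]
    rw [this]
    nlinarith [P.T_pos]
  have h3 : P.system.itemUtility x (.inl k) (k, .reserved .E) =
      1 - P.floor * auxMax x k .E := by
    refine itemUtility_reserved_eq hx0 ?_
    simpa only [reservePrice, reservedValue, mul_one] using hE
  have h4 : P.system.itemUtility x (.inl k) (k, .reserved .ceiling) ≤ 0 := by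
    refine (itemUtility_reserved_le hx0 _).trans (max_le le_rfl ?_)
    simp only [reservePrice, reservedValue]
    have h5 : 1 ≤ P.high * auxMax x k .ceiling := by
      nlinarith [hA .ceiling, P.one_lt_high, hε.one_lt]
    nlinarith [P.M_pos k]
  have h5 : ∑ l ∈ Finset.univ.filter (fun l => k ∈ D.inputs l),
      P.system.itemUtility x (.inl k) (l, .L) ≤ 0 := by
    refine Finset.sum_nonpos fun l hl => ?_
    refine itemUtility_L_input_nonpos hD (Finset.mem_filter.1 hl).2 ?_
    have h6 : (1 - ε) * P.C ≤ x (.inl l) * P.C := by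
      have := (hx (.inl l)).le
      gcongr
      exact P.C_pos.le
    have h7 : 1 * P.V ≤ P.high * (1 + ε) * P.V := by
      gcongr
      nlinarith [P.one_lt_high]
    linarith
  have h6 : P.C * (1 - ε) ≤ P.C * auxMax x k .H := by
    have := (hA .H).le
    gcongr
    exact P.C_pos.le
  have h7 : P.floor * (1 - ε) ≤ P.floor * auxMax x k .E := by
    have := (hA .E).le
    gcongr
    linarith [P.one_le_floor]
  rw [utility_inl hD hx0, h2, h3]
  linarith

theorem sum_itemUtility_L_input_eq_zero (hD : ∀ k, k ∉ D.inputs k) (hε : P.IsTolerance ε)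
    (hx : ∀ b, 1 - ε < x b) (hk : x (.inl k) < P.high * (1 + ε)) :
    ∑ l ∈ Finset.univ.filter (fun l => k ∈ D.inputs l),
      P.system.itemUtility x (.inl k) (l, .L) = 0 := by
  refine Finset.sum_eq_zero fun l hl => ?_
  refine itemUtility_L_input_eq_zero hD (Finset.mem_filter.1 hl).2 ?_
  have h1 := hε.high_lt
  have h2 := hx (.inl l)
  have h3 := P.C_pos
  have h4 := P.V_pos
  nlinarith

/-- A gate without true inputs moves up to `high`. -/
theorem le_utility_of_inputs_low (hD : ∀ k, k ∉ D.inputs k) (hε : P.IsTolerance ε)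
    (hx : ∀ b, 1 - ε < x b) (hA : ∀ r, auxMax x k r < 1 + ε)
    (hin : ∀ j ∈ D.inputs k, x (.inl j) ≤ (P.low + P.threshold) / 2)
    (hk : x (.inl k) < P.high * auxMax x k .ceiling) :
    P.T - (P.low + P.threshold) / 2 * P.V - (P.C + P.floor) * ε ≤
      P.system.utility x (.inl k) := by
  have hx0 : ∀ b, 0 < x b := fun b => by linarith [hx b, hε.lt_one]
  have hV := P.V_pos
  have hC := P.C_pos
  have hlow := P.one_lt_low
  have hthr := P.low_lt_threshold
  have hhigh := P.threshold_lt_high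
  have hε0 := hε.pos
  have hA1 := fun r => (hA r).le
  have h0 : x (.inl k) < P.high * (1 + ε) :=
    hk.trans (mul_lt_mul_of_pos_left (hA _) (by linarith))
  have h1 : P.C - (P.low + P.threshold) / 2 * P.V ≤
      P.system.itemUtility x (.inl k) (k, .L) := by
    refine le_itemUtility_L (by linarith) hin ?_
    have e1 := hε.high_lt
    have e2 : (1 - ε) * P.C ≤ x (.inl k) * P.C := by
      have := (hx (.inl k)).le
      gcongr
    have e3 : (P.low + P.threshold) / 2 * P.V ≤ P.high * (1 + ε) * P.V := by
      gcongr
      nlinarith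
    linarith
  have h2 := le_itemUtility_reserved (P := P) (k := k) hx0 .H
  have h3 := le_itemUtility_reserved (P := P) (k := k) hx0 .E
  have h4 : P.system.itemUtility x (.inl k) (k, .reserved .ceiling) = 0 := by
    refine itemUtility_reserved_eq_zero ?_
    simp only [reservePrice, reservedValue]
    nlinarith [P.M_pos k]
  have h6 : P.C * auxMax x k .H ≤ P.C * (1 + ε) := by
    have := hA1 .H
    gcongr
  have h7 : P.floor * auxMax x k .E ≤ P.floor * (1 + ε) := by
    have := hA1 .E
    gcongr
    linarith [P.one_le_floor]
  have h8 : P.T - P.C - P.C * ε ≤ P.system.itemUtility x (.inl k) (k, .reserved .H) := by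
    refine (le_min ?_ ?_).trans h2
    · nlinarith [P.T_lt_C]
    · simp only [reservePrice, reservedValue]
      linarith
  have h9 : 1 - P.floor - P.floor * ε ≤ P.system.itemUtility x (.inl k) (k, .reserved .E) := by
    refine (le_min ?_ ?_).trans h3
    · nlinarith [P.one_le_floor]
    · simp only [reservePrice, reservedValue]
      linarith
  rw [utility_inl hD hx0, h4, sum_itemUtility_L_input_eq_zero hD hε hx h0]
  linarith

/-- A gate moves up to `low`, whatever its inputs. -/
theorem le_utility_of_lt_low (hD : ∀ k, k ∉ D.inputs k) (hε : P.IsTolerance ε)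
    (hx : ∀ b, 1 - ε < x b) (hA : ∀ r, auxMax x k r < 1 + ε)
    (hin : ∀ j ∈ D.inputs k, x (.inl j) ≤ (P.high + P.low * P.threshold) / 2)
    (hk : x (.inl k) < P.low * auxMax x k .H) (hkc : x (.inl k) < P.high * auxMax x k .ceiling) :
    P.C * (1 - ε) - (P.high + P.low * P.threshold) / 2 * P.V - P.floor * ε ≤
      P.system.utility x (.inl k) := by
  have hx0 : ∀ b, 0 < x b := fun b => by linarith [hx b, hε.lt_one]
  have hV := P.V_pos
  have hC := P.C_pos
  have hlow := P.one_lt_low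
  have hthr := P.low_lt_threshold
  have hhigh := P.threshold_lt_high
  have hlt := P.high_lt
  have hε0 := hε.pos
  have h0 : x (.inl k) < P.high * (1 + ε) :=
    hkc.trans (mul_lt_mul_of_pos_left (hA _) (by linarith))
  have h1 : P.C - (P.high + P.low * P.threshold) / 2 * P.V ≤
      P.system.itemUtility x (.inl k) (k, .L) := by
    refine le_itemUtility_L (by linarith) hin ?_
    have e1 := hε.above_low
    have e2 : (1 - ε) * P.C ≤ x (.inl k) * P.C := by
      have := (hx (.inl k)).le
      gcongr
    nlinarith [P.one_le_floor]
  have h2 : P.system.itemUtility x (.inl k) (k, .reserved .H) = 0 := by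
    refine itemUtility_reserved_eq_zero ?_
    simp only [reservePrice, reservedValue]
    have : P.C = P.low * P.T := by rw [C, T, mul_assoc]
    rw [this]
    nlinarith [P.T_pos]
  have h3 := le_itemUtility_reserved (P := P) (k := k) hx0 .E
  have h4 : P.system.itemUtility x (.inl k) (k, .reserved .ceiling) = 0 := by
    refine itemUtility_reserved_eq_zero ?_
    simp only [reservePrice, reservedValue]
    nlinarith [P.M_pos k]
  have h7 : P.floor * auxMax x k .E ≤ P.floor * (1 + ε) := by
    have := (hA .E).le
    gcongr
    linarith [P.one_le_floor]
  have h9 : 1 - P.floor - P.floor * ε ≤ P.system.itemUtility x (.inl k) (k, .reserved .E) := by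
    refine (le_min ?_ ?_).trans h3
    · nlinarith [P.one_le_floor]
    · simp only [reservePrice, reservedValue]
      linarith
  rw [utility_inl hD hx0, h2, h4, sum_itemUtility_L_input_eq_zero hD hε hx h0]
  nlinarith

/-! ### Bounds for the utilities of the auxiliary bidders -/

theorem v_aux_reserved (r : ReservedItem) (s : Fin 2) :
    P.system.v (.inr (k, r, s)) (k, .reserved r) = P.reservePrice k r := by
  simp [system, value]

theorem v_aux_aux (r : ReservedItem) (s : Fin 2) :
    P.system.v (.inr (k, r, s)) (k, .aux r) = 1 := by
  simp [system, value]

theorem itemUtility_aux_reserved_le {r : ReservedItem} {s s' : Fin 2} (hs : s' ≠ s) :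
    P.system.itemUtility x (.inr (k, r, s)) (k, .reserved r) ≤
      P.reservePrice k r * max 0 (1 - x (.inr (k, r, s'))) := by
  have hR := P.reservePrice_pos k r
  refine itemUtility_le_of_bid_le (s := .inr (k, r, s')) (by simpa using hs) ?_
    (mul_nonneg hR.le (le_max_left _ _))
  rw [bid, v_aux_reserved, v_aux_reserved]
  nlinarith [le_max_right 0 (1 - x (.inr (k, r, s')))]

theorem itemUtility_aux_aux_le {r : ReservedItem} {s s' : Fin 2} (hs : s' ≠ s) :
    P.system.itemUtility x (.inr (k, r, s)) (k, .aux r) ≤ max 0 (1 - x (.inr (k, r, s'))) := by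
  refine itemUtility_le_of_bid_le (s := .inr (k, r, s')) (by simpa using hs) ?_ (le_max_left _ _)
  rw [bid, v_aux_aux, v_aux_aux, mul_one]
  exact le_max_right _ _

theorem utility_aux_le (hx : ∀ b, 0 < x b) {r : ReservedItem} {s s' : Fin 2} (hs : s' ≠ s) :
    P.system.utility x (.inr (k, r, s)) ≤
      (P.reservePrice k r + 1) * max 0 (1 - x (.inr (k, r, s'))) := by
  rw [utility_inr hx, add_mul, one_mul]
  exact add_le_add (itemUtility_aux_reserved_le hs) (itemUtility_aux_aux_le hs)

theorem utility_aux_eq_zero (hx : ∀ b, 0 < x b) {r : ReservedItem} {s s' : Fin 2}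
    (h : x (.inr (k, r, s)) < x (.inr (k, r, s'))) :
    P.system.utility x (.inr (k, r, s)) = 0 := by
  have hR := P.reservePrice_pos k r
  rw [utility_inr hx, itemUtility_eq_zero_of_lt (s := .inr (k, r, s')),
    itemUtility_eq_zero_of_lt (s := .inr (k, r, s')), add_zero]
  · rw [bid, bid, v_aux_aux, v_aux_aux]
    linarith
  · rw [bid, bid, v_aux_reserved, v_aux_reserved]
    gcongr

theorem utility_aux_le_of_winner {η : ℝ} (hη : 0 ≤ η) (hx : ∀ b, 0 < x b) {r : ReservedItem}
    {s s' : Fin 2} (hs : s' ≠ s) (h : 1 + η ≤ x (.inr (k, r, s')))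
    (hle : x (.inr (k, r, s')) ≤ x (.inr (k, r, s))) :
    P.system.utility x (.inr (k, r, s)) ≤ -η * (1 / (Fintype.card (GateBidder N) : ℝ)) := by
  have hne : (.inr (k, r, s') : GateBidder N) ≠ .inr (k, r, s) := by simpa using hs
  have h1 : P.system.itemUtility x (.inr (k, r, s)) (k, .reserved r) ≤ 0 := by
    have := itemUtility_aux_reserved_le (P := P) (x := x) (k := k) (r := r) hs
    rwa [max_eq_left (by linarith), mul_zero] at this
  have h2 : 1 / (Fintype.card (GateBidder N) : ℝ) ≤
      P.system.alloc x (.inr (k, r, s)) (k, .aux r) := by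
    refine inv_card_le_alloc ?_
    have h3 : P.system.bid x (.inr (k, r, s)) (k, .aux r) = x (.inr (k, r, s)) := by
      rw [bid, v_aux_aux, mul_one]
    rw [h3]
    rintro (i | ⟨i, r', t⟩)
    · have : P.system.v (.inl i) (k, .aux r) = 0 := rfl
      rw [bid, this, mul_zero]
      exact (hx _).le
    · by_cases hir : i = k ∧ r' = r
      · obtain ⟨rfl, rfl⟩ := hir
        rw [bid, v_aux_aux, mul_one]
        rcases eq_or_ne t s with rfl | hts
        · exact le_rfl
        · rwa [show t = s' by omega]
      · have : P.system.v (.inr (i, r', t)) (k, .aux r) = 0 := by simp [system, value, hir]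
        rw [bid, this, mul_zero]
        exact (hx _).le
  have h4 : 1 + η ≤ P.system.price x (.inr (k, r, s)) (k, .aux r) := by
    refine h.trans ?_
    have := bid_le_price (S := P.system) (m := x) (j := (k, .aux r)) hne
    rwa [bid, v_aux_aux, mul_one] at this
  have h5 : P.system.itemUtility x (.inr (k, r, s)) (k, .aux r) ≤
      -η * (1 / (Fintype.card (GateBidder N) : ℝ)) := by
    rw [itemUtility, v_aux_aux]
    have h6 : (0 : ℝ) ≤ 1 / (Fintype.card (GateBidder N) : ℝ) := by positivity
    nlinarith
  rw [utility_inr hx]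
  linarith

theorem utility_aux_add_le {η : ℝ} (hη : 0 ≤ η) (hx : ∀ b, 0 < x b) {r : ReservedItem}
    (h : ∀ s, 1 + η < x (.inr (k, r, s))) :
    P.system.utility x (.inr (k, r, 0)) + P.system.utility x (.inr (k, r, 1)) ≤
      -η * (1 / (Fintype.card (GateBidder N) : ℝ)) := by
  have hnonpos : ∀ s s' : Fin 2, s' ≠ s → P.system.utility x (.inr (k, r, s)) ≤ 0 := by
    intro s s' hs
    have := utility_aux_le (P := P) (k := k) (r := r) hx hs
    rwa [max_eq_left (by linarith [h s']), mul_zero] at this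
  rcases le_total (x (.inr (k, r, 1))) (x (.inr (k, r, 0))) with hle | hle
  · have h1 := utility_aux_le_of_winner (P := P) hη hx (by decide) (h 1).le hle
    linarith [hnonpos 1 0 (by decide)]
  · have h1 := utility_aux_le_of_winner (P := P) hη hx (by decide) (h 0).le hle
    linarith [hnonpos 0 1 (by decide)]

end GateParams

/-! ### Solutions under eventual drift conditions -/

namespace IsSolution

variable {B : Type} [Fintype B] {U : (B → ℝ) → (B → ℝ)} {m : ℝ → B → ℝ}

theorem le_of_drift_nonpos (hm : IsSolution U m) {b : B} {u : ℝ}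
    (h : ∀ t, 0 ≤ t → u < m t b → ∀ g ∈ filippov U (m t), g b ≤ 0) (h0 : m 0 b ≤ u)
    {t : ℝ} (ht : 0 ≤ t) : m t b ≤ u := by
  refine le_of_barrier (hm.continuousOn_apply b) (fun c d hc hcd hlt => ?_) h0 ht
  have := hm.drift_le b (c := 0) hc hcd fun τ hτ => h τ (hc.trans hτ.1.le) (hlt τ hτ)
  linarith

theorem ge_of_drift_nonneg (hm : IsSolution U m) {b : B} {u : ℝ}
    (h : ∀ t, 0 ≤ t → m t b < u → ∀ g ∈ filippov U (m t), 0 ≤ g b) (h0 : u ≤ m 0 b)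
    {t : ℝ} (ht : 0 ≤ t) : u ≤ m t b := by
  refine ge_of_barrier (hm.continuousOn_apply b) (fun c d hc hcd hlt => ?_) h0 ht
  have := hm.le_drift b (c := 0) hc hcd fun τ hτ => h τ (hc.trans hτ.1.le) (hlt τ hτ)
  linarith

theorem eventually_le (hm : IsSolution U m) {b : B} {u η : ℝ} (hη : 0 < η)
    (h : ∀ᶠ t in atTop, u < m t b → ∀ g ∈ filippov U (m t), g b ≤ -η) :
    ∀ᶠ t in atTop, m t b ≤ u := by
  obtain ⟨s, hs⟩ := eventually_atTop.1 (h.and (eventually_ge_atTop 0))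
  have hs0 : 0 ≤ s := (hs s le_rfl).2
  refine eventually_le_of_drift hη
    ((hm.continuousOn_apply b).mono (Set.Ici_subset_Ici.2 hs0)) fun c d hc hcd hlt => ?_
  exact hm.drift_le b (hs0.trans hc) hcd fun τ hτ => (hs τ (hc.trans hτ.1.le)).1 (hlt τ hτ)

theorem eventually_ge (hm : IsSolution U m) {b : B} {u η : ℝ} (hη : 0 < η)
    (h : ∀ᶠ t in atTop, m t b < u → ∀ g ∈ filippov U (m t), η ≤ g b) :
    ∀ᶠ t in atTop, u ≤ m t b := by
  obtain ⟨s, hs⟩ := eventually_atTop.1 (h.and (eventually_ge_atTop 0))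
  have hs0 : 0 ≤ s := (hs s le_rfl).2
  refine eventually_ge_of_drift hη
    ((hm.continuousOn_apply b).mono (Set.Ici_subset_Ici.2 hs0)) fun c d hc hcd hlt => ?_
  exact hm.le_drift b (hs0.trans hc) hcd fun τ hτ => (hs τ (hc.trans hτ.1.le)).1 (hlt τ hτ)

end IsSolution

/-- `V` arises from `U` by replacing some of its values by `0`. -/
def IsTruncation {B : Type} (V U : (B → ℝ) → (B → ℝ)) : Prop := ∀ y, V y = U y ∨ V y = 0

theorem IsTruncation.refl {B : Type} (U : (B → ℝ) → (B → ℝ)) : IsTruncation U U := fun _ =>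
  Or.inl rfl

theorem IsTruncation.apply_le {B : Type} {V U : (B → ℝ) → (B → ℝ)} (h : IsTruncation V U)
    {y : B → ℝ} {b : B} {c : ℝ} (hc : 0 ≤ c) (hy : U y b ≤ c) : V y b ≤ c := by
  rcases h y with e | e <;> rw [e]
  · exact hy
  · exact hc

theorem IsTruncation.apply_nonneg {B : Type} {V U : (B → ℝ) → (B → ℝ)} (h : IsTruncation V U)
    {y : B → ℝ} {b : B} (hy : 0 ≤ U y b) : 0 ≤ V y b := by
  rcases h y with e | e <;> rw [e]
  · exact hy
  · exact le_rfl

theorem eventually_lt_of_mem_multipliers {B : Type} [Finite B] {x : B → ℝ}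
    (hx : x ∈ multipliers B) {c : ℝ} (hc : c < 1) : ∀ᶠ y in 𝓝 x, ∀ b, c < y b :=
  eventually_all.2 fun b =>
    (continuous_apply b).continuousAt.eventually_const_lt (hc.trans_le (hx b))

theorem abs_sub_lt_of_mem_ball {ι : Type} {_ : Fintype ι} {x y : ι → ℝ} {δ : ℝ}
    (h : x ∈ Metric.ball y δ) (i : ι) : |x i - y i| < δ :=
  (dist_pi_lt_iff (dist_nonneg.trans_lt h)).1 h i

theorem ae_forall_ne {ι : Type} [Fintype ι] (c : ℝ) : ∀ᵐ x : ι → ℝ, ∀ b, x b ≠ c := by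
  refine eventually_countable_forall.2 fun b => ?_
  have h := Measure.pi_hyperplane (fun _ : ι => (volume : Measure ℝ)) b c
  refine measure_mono_null (fun x hx => ?_) h
  simpa using hx

theorem one_le_auxMax {N : ℕ} {x : GateBidder N → ℝ} (hx : x ∈ multipliers (GateBidder N))
    (k : Fin N) (r : ReservedItem) : 1 ≤ auxMax x k r :=
  (hx _).trans (le_auxMax x k r 0)

namespace GateParams

variable {N : ℕ} {D : NORNetwork N} {P : GateParams D} {x g : GateBidder N → ℝ}
  {V : (GateBidder N → ℝ) → (GateBidder N → ℝ)} {k : Fin N} {ε : ℝ}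

/-! ### Bounds for the regularized utilities -/

theorem filippov_nonneg (hV : IsTruncation V P.system.utility) {b : GateBidder N} (hb : x b < 1)
    (hg : g ∈ filippov V x) : 0 ≤ g b := by
  refine le_filippov_apply b ?_ hg
  filter_upwards [(continuous_apply b).continuousAt.eventually_lt_const hb] with y hy
  exact hV.apply_nonneg (ROSSystem.utility_nonneg hy.le)

theorem filippov_aux_nonpos (hV : IsTruncation V P.system.utility)
    (hx : x ∈ multipliers (GateBidder N)) (q : Fin N × ReservedItem × Fin 2)
    (hg : g ∈ filippov V x) : g (.inr q) ≤ 0 := by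
  obtain ⟨k, r, s⟩ := q
  obtain ⟨s', hs⟩ : ∃ s' : Fin 2, s' ≠ s := ⟨s + 1, by omega⟩
  refine le_of_forall_pos_le_add fun c hc => ?_
  rw [zero_add]
  refine filippov_apply_le _ ?_ hg
  have hcont : Continuous fun y : GateBidder N → ℝ =>
      (P.reservePrice k r + 1) * max 0 (1 - y (.inr (k, r, s'))) := by fun_prop
  have h0 : (P.reservePrice k r + 1) * max 0 (1 - x (.inr (k, r, s'))) < c := by
    rwa [max_eq_left (by linarith [hx (.inr (k, r, s'))]), mul_zero]
  filter_upwards [eventually_lt_of_mem_multipliers hx zero_lt_one,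
    hcont.continuousAt.eventually_lt_const h0] with y hy hyc
  exact hV.apply_le hc.le ((utility_aux_le hy hs).trans hyc.le)

theorem filippov_aux_nonneg (hx : x ∈ multipliers (GateBidder N)) {r : ReservedItem}
    {s s' : Fin 2} (h : x (.inr (k, r, s)) < x (.inr (k, r, s')))
    (hg : g ∈ filippov P.system.utility x) : 0 ≤ g (.inr (k, r, s)) := by
  refine le_filippov_apply _ ?_ hg
  filter_upwards [eventually_lt_of_mem_multipliers hx zero_lt_one,
    (continuous_apply (Sum.inr (k, r, s))).continuousAt.eventually_lt
      (continuous_apply (Sum.inr (k, r, s'))).continuousAt h] with y hy hlt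
  exact (utility_aux_eq_zero hy hlt).ge

theorem filippov_aux_add_le (hx : x ∈ multipliers (GateBidder N)) {η : ℝ} (hη : 0 ≤ η)
    {r : ReservedItem} (h : ∀ s, 1 + η < x (.inr (k, r, s)))
    (hg : g ∈ filippov P.system.utility x) :
    g (.inr (k, r, 0)) + g (.inr (k, r, 1)) ≤
      -η * (1 / (Fintype.card (GateBidder N) : ℝ)) := by
  let φ : (GateBidder N → ℝ) →L[ℝ] ℝ :=
    ContinuousLinearMap.proj (.inr (k, r, 0)) + ContinuousLinearMap.proj (.inr (k, r, 1))
  refine filippov_le φ ?_ hg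
  have h1 : ∀ᶠ y in 𝓝 x, ∀ s, 1 + η < y (.inr (k, r, s)) := eventually_all.2 fun s =>
    (continuous_apply (Sum.inr (k, r, s))).continuousAt.eventually_const_lt (h s)
  filter_upwards [eventually_lt_of_mem_multipliers hx zero_lt_one, h1] with y hy hlt
  exact utility_aux_add_le hη hy hlt

theorem eventually_utility_le_of_ceiling_lt (hD : ∀ k, k ∉ D.inputs k)
    (hx : x ∈ multipliers (GateBidder N)) (h : P.high * auxMax x k .ceiling < x (.inl k)) :
    ∀ᶠ y in 𝓝 x, P.system.utility y (.inl k) ≤ -(P.slack k / 2) := by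
  have hA := continuous_auxMax k .ceiling
  have hs := P.slack_pos k
  have h1 : P.high * P.M k * (1 - auxMax x k .ceiling) - P.slack k < -(P.slack k / 2) := by
    have h2 : 0 < P.high * P.M k := mul_pos (zero_lt_one.trans P.one_lt_high) (P.M_pos k)
    nlinarith [one_le_auxMax hx k .ceiling]
  filter_upwards [eventually_lt_of_mem_multipliers hx zero_lt_one,
    (by fun_prop : Continuous fun y : GateBidder N → ℝ =>
      P.high * auxMax y k .ceiling).continuousAt.eventually_lt
      (continuous_apply (Sum.inl k)).continuousAt h,
    (by fun_prop : Continuous fun y : GateBidder N → ℝ =>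
      P.high * P.M k * (1 - auxMax y k .ceiling) - P.slack k).continuousAt.eventually_lt_const h1]
    with y hy hyk hys
  exact (utility_le_of_ceiling_lt hD hy hyk).trans hys.le

theorem filippov_nonpos_of_ceiling_lt (hV : IsTruncation V P.system.utility)
    (hD : ∀ k, k ∉ D.inputs k) (hx : x ∈ multipliers (GateBidder N))
    (h : P.high * auxMax x k .ceiling < x (.inl k)) (hg : g ∈ filippov V x) : g (.inl k) ≤ 0 := by
  refine filippov_apply_le _ ?_ hg
  filter_upwards [eventually_utility_le_of_ceiling_lt hD hx h] with y hy
  exact hV.apply_le le_rfl (hy.trans (by linarith [P.slack_pos k]))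

theorem filippov_le_of_ceiling_lt (hD : ∀ k, k ∉ D.inputs k)
    (hx : x ∈ multipliers (GateBidder N)) (h : P.high * auxMax x k .ceiling < x (.inl k))
    (hg : g ∈ filippov P.system.utility x) : g (.inl k) ≤ -(P.slack k / 2) :=
  filippov_apply_le _ (eventually_utility_le_of_ceiling_lt hD hx h) hg

theorem filippov_le_of_input (hD : ∀ k, k ∉ D.inputs k) (hε : P.IsTolerance ε)
    (hx : x ∈ multipliers (GateBidder N)) {j : Fin N} (hj : j ∈ D.inputs k)
    (hjx : (P.threshold + P.high) / 2 < x (.inl j))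
    (hA : auxMax x k .E < 1 + ε) (hH : P.low * auxMax x k .H < x (.inl k))
    (hg : g ∈ filippov P.system.utility x) :
    g (.inl k) ≤ P.T - (P.threshold + P.high) / 2 * P.V + (P.C + P.floor) * ε := by
  refine filippov_apply_le _ ?_ hg
  have hE : P.floor * auxMax x k .E < x (.inl k) := by
    have h1 := hε.floor_lt
    have h2 := one_le_auxMax hx k .H
    nlinarith [P.one_le_floor, P.one_lt_low]
  have hAH := continuous_auxMax k .H
  have hAE := continuous_auxMax k .E
  filter_upwards [eventually_lt_of_mem_multipliers hx (by linarith [hε.pos] : 1 - ε < 1),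
    (continuous_apply (Sum.inl j)).continuousAt.eventually_const_lt hjx,
    (by fun_prop : Continuous fun y : GateBidder N → ℝ =>
      P.low * auxMax y k .H).continuousAt.eventually_lt
      (continuous_apply (Sum.inl k)).continuousAt hH,
    (by fun_prop : Continuous fun y : GateBidder N → ℝ =>
      P.floor * auxMax y k .E).continuousAt.eventually_lt
      (continuous_apply (Sum.inl k)).continuousAt hE] with y h1 h2 h3 h4
  exact utility_le_of_input hD hε h1 hj h2.le h3 h4

theorem eventually_inputs_lt {c : ℝ} (hin : ∀ j ∈ D.inputs k, x (.inl j) < c) :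
    ∀ᶠ y in 𝓝 x, ∀ j ∈ D.inputs k, y (.inl j) < c :=
  eventually_all.2 fun j => by
    by_cases hj : j ∈ D.inputs k
    · filter_upwards [(continuous_apply (Sum.inl j)).continuousAt.eventually_lt_const (hin j hj)]
        with y hy _ using hy
    · exact Eventually.of_forall fun y h => absurd h hj

theorem eventually_auxMax_lt {c : ℝ} (hA : ∀ r, auxMax x k r < c) :
    ∀ᶠ y in 𝓝 x, ∀ r, auxMax y k r < c :=
  eventually_all.2 fun r => (continuous_auxMax k r).continuousAt.eventually_lt_const (hA r)

theorem le_filippov_of_inputs_low (hD : ∀ k, k ∉ D.inputs k) (hε : P.IsTolerance ε)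
    (hx : x ∈ multipliers (GateBidder N)) (hA : ∀ r, auxMax x k r < 1 + ε)
    (hin : ∀ j ∈ D.inputs k, x (.inl j) < (P.low + P.threshold) / 2)
    (hk : x (.inl k) < P.high) (hg : g ∈ filippov P.system.utility x) :
    P.T - (P.low + P.threshold) / 2 * P.V - (P.C + P.floor) * ε ≤ g (.inl k) := by
  refine le_filippov_apply _ ?_ hg
  have hc : x (.inl k) < P.high * auxMax x k .ceiling := by
    nlinarith [one_le_auxMax hx k .ceiling, P.one_lt_high]
  have hAc := continuous_auxMax k .ceiling
  filter_upwards [eventually_lt_of_mem_multipliers hx (by linarith [hε.pos] : 1 - ε < 1),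
    eventually_auxMax_lt hA, eventually_inputs_lt hin,
    (continuous_apply (Sum.inl k)).continuousAt.eventually_lt
      (by fun_prop : Continuous fun y : GateBidder N → ℝ =>
        P.high * auxMax y k .ceiling).continuousAt hc] with y h1 h2 h3 h4
  exact le_utility_of_inputs_low hD hε h1 h2 (fun j hj => (h3 j hj).le) h4

theorem le_filippov_of_lt_low (hD : ∀ k, k ∉ D.inputs k) (hε : P.IsTolerance ε)
    (hx : x ∈ multipliers (GateBidder N)) (hA : ∀ r, auxMax x k r < 1 + ε)
    (hin : ∀ j ∈ D.inputs k, x (.inl j) < (P.high + P.low * P.threshold) / 2)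
    (hk : x (.inl k) < P.low) (hg : g ∈ filippov P.system.utility x) :
    P.C * (1 - ε) - (P.high + P.low * P.threshold) / 2 * P.V - P.floor * ε ≤ g (.inl k) := by
  refine le_filippov_apply _ ?_ hg
  have hlh : P.low < P.high := P.low_lt_threshold.trans P.threshold_lt_high
  have hH : x (.inl k) < P.low * auxMax x k .H := by
    nlinarith [one_le_auxMax hx k .H, P.one_lt_low]
  have hc : x (.inl k) < P.high * auxMax x k .ceiling := by
    nlinarith [one_le_auxMax hx k .ceiling, P.one_lt_high]
  have hAc := continuous_auxMax k .ceiling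
  have hAH := continuous_auxMax k .H
  filter_upwards [eventually_lt_of_mem_multipliers hx (by linarith [hε.pos] : 1 - ε < 1),
    eventually_auxMax_lt hA, eventually_inputs_lt hin,
    (continuous_apply (Sum.inl k)).continuousAt.eventually_lt
      (by fun_prop : Continuous fun y : GateBidder N → ℝ =>
        P.low * auxMax y k .H).continuousAt hH,
    (continuous_apply (Sum.inl k)).continuousAt.eventually_lt
      (by fun_prop : Continuous fun y : GateBidder N → ℝ =>
        P.high * auxMax y k .ceiling).continuousAt hc] with y h1 h2 h3 h4 h5
  exact le_utility_of_lt_low hD hε h1 h2 (fun j hj => (h3 j hj).le) h4 h5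

/-! ### A priori bounds and existence -/

section Trajectory

variable {m : ℝ → GateBidder N → ℝ}

theorem mem_multipliers (hV : IsTruncation V P.system.utility) (hm : IsSolution V m)
    (h0 : m 0 ∈ multipliers (GateBidder N)) {t : ℝ} (ht : 0 ≤ t) :
    m t ∈ multipliers (GateBidder N) := fun b =>
  hm.ge_of_drift_nonneg (fun _ _ hb _ hg => filippov_nonneg hV hb hg) (h0 b) ht

theorem aux_antitone (hV : IsTruncation V P.system.utility) (hm : IsSolution V m)
    (h0 : m 0 ∈ multipliers (GateBidder N)) (q : Fin N × ReservedItem × Fin 2) {s t : ℝ}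
    (hs : 0 ≤ s) (hst : s ≤ t) : m t (.inr q) ≤ m s (.inr q) := by
  have := hm.drift_le (.inr q) (c := 0) hs hst fun τ hτ _ hg =>
    filippov_aux_nonpos hV (mem_multipliers hV hm h0 (hs.trans hτ.1.le)) q hg
  linarith

theorem auxMax_antitone (hV : IsTruncation V P.system.utility) (hm : IsSolution V m)
    (h0 : m 0 ∈ multipliers (GateBidder N)) (k : Fin N) (r : ReservedItem) {s t : ℝ}
    (hs : 0 ≤ s) (hst : s ≤ t) : auxMax (m t) k r ≤ auxMax (m s) k r :=
  max_le_max (aux_antitone hV hm h0 _ hs hst) (aux_antitone hV hm h0 _ hs hst)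

theorem inl_le_of_auxMax_le (hV : IsTruncation V P.system.utility) (hD : ∀ k, k ∉ D.inputs k)
    (hm : IsSolution V m) (h0 : m 0 ∈ multipliers (GateBidder N)) {u : ℝ}
    (hu : P.high * auxMax (m 0) k .ceiling ≤ u) (hk : m 0 (.inl k) ≤ u) {t : ℝ} (ht : 0 ≤ t) :
    m t (.inl k) ≤ u := by
  refine hm.le_of_drift_nonpos (fun s hs hlt g hg => ?_) hk ht
  refine filippov_nonpos_of_ceiling_lt hV hD (mem_multipliers hV hm h0 hs) ?_ hg
  have h1 := auxMax_antitone hV hm h0 k .ceiling le_rfl hs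
  nlinarith [P.one_lt_high]

theorem exists_norm_utility_le (R : ℝ) :
    ∃ L, ∀ y : GateBidder N → ℝ, ‖y‖ ≤ R → ‖P.system.utility y‖ ≤ L := by
  let S := P.system
  refine ⟨∑ b, ∑ j, (S.v b j + |R| * ∑ s, S.v s j), fun y hy => ?_⟩
  have hnn : ∀ b j, 0 ≤ S.v b j + |R| * ∑ s, S.v s j := fun b j =>
    add_nonneg (S.nonneg b j)
      (mul_nonneg (abs_nonneg R) (Finset.sum_nonneg fun s _ => S.nonneg s j))
  refine (pi_norm_le_iff_of_nonneg
    (Finset.sum_nonneg fun b _ => Finset.sum_nonneg fun j _ => hnn b j)).2 fun b => ?_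
  refine le_trans ?_ (Finset.single_le_sum (f := fun b => ∑ j, (S.v b j + |R| * ∑ s, S.v s j))
    (fun b _ => Finset.sum_nonneg fun j _ => hnn b j) (Finset.mem_univ b))
  rw [ROSSystem.utility_eq_sum]
  refine norm_sum_le_of_le _ fun j _ => ?_
  have hbid : ∀ s, |S.bid y s j| ≤ |R| * ∑ s, S.v s j := by
    intro s
    rw [ROSSystem.bid, abs_mul, abs_of_nonneg (S.nonneg s j)]
    have h1 : |y s| ≤ |R| := (norm_le_pi_norm y s).trans (hy.trans (le_abs_self R))
    have h2 := Finset.single_le_sum (f := fun s => S.v s j) (fun s _ => S.nonneg s j)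
      (Finset.mem_univ s)
    exact mul_le_mul h1 h2 (S.nonneg s j) (abs_nonneg R)
  have hp1 : S.price y b j ≤ |R| * ∑ s, S.v s j :=
    ROSSystem.price_le fun s _ => (le_abs_self _).trans (hbid s)
  have hp2 : -(|R| * ∑ s, S.v s j) ≤ S.price y b j := by
    obtain ⟨s, hs⟩ := GateBidder.nonempty_ne b
    exact (abs_le.1 (hbid s)).1.trans (ROSSystem.bid_le_price hs)
  have hv := S.nonneg b j
  rw [ROSSystem.itemUtility, norm_mul]
  refine (mul_le_of_le_one_left (norm_nonneg _) ?_).trans ?_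
  · rw [Real.norm_of_nonneg ROSSystem.alloc_nonneg]
    exact ROSSystem.alloc_le_one
  · exact abs_le.2 ⟨by linarith, by linarith⟩

/-- The ROS dynamics has a solution from every initial condition in the state space. -/
theorem exists_isSolution (hD : ∀ k, k ∉ D.inputs k) {x₀ : GateBidder N → ℝ}
    (hx₀ : x₀ ∈ multipliers (GateBidder N)) :
    ∃ m, IsSolution P.system.utility m ∧ m 0 = x₀ := by
  classical
  obtain ⟨u, hu⟩ : ∃ u : ℝ, ∀ b, x₀ b ≤ u := by
    refine ⟨‖x₀‖, fun b => (le_abs_self _).trans (norm_le_pi_norm x₀ b)⟩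
  have hh := P.one_lt_high
  set R : ℝ := P.high * max u 1 + 1 with hR
  have hu1 : 1 ≤ max u 1 := le_max_right _ _
  obtain ⟨L, hL⟩ := P.exists_norm_utility_le R
  let V : (GateBidder N → ℝ) → (GateBidder N → ℝ) := fun y =>
    if ‖y‖ < R then P.system.utility y else 0
  have hV : IsTruncation V P.system.utility := fun y => by
    by_cases h : ‖y‖ < R
    · exact Or.inl (if_pos h)
    · exact Or.inr (if_neg h)
  have hVL : ∀ y, ‖V y‖ ≤ |L| := fun y => by
    by_cases h : ‖y‖ < R
    · simp only [V, if_pos h]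
      exact (hL y h.le).trans (le_abs_self L)
    · simp only [V, if_neg h, norm_zero]
      exact abs_nonneg L
  obtain ⟨m, hm, hm0⟩ := _root_.exists_isSolution hVL x₀
  refine ⟨m, hm.mono fun t ht => filippov_subset_of_eventuallyEq ?_, hm0⟩
  have h0 : m 0 ∈ multipliers (GateBidder N) := hm0 ▸ hx₀
  have hub : ∀ b, m t b ≤ P.high * max u 1 := by
    rintro (k | q)
    · refine inl_le_of_auxMax_le hV hD hm h0 ?_ ?_ ht
      · have : auxMax (m 0) k .ceiling ≤ max u 1 := by
          rw [hm0]
          exact max_le ((hu _).trans (le_max_left _ _)) ((hu _).trans (le_max_left _ _))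
        gcongr
      · rw [hm0]
        have := (hu (.inl k)).trans (le_max_left u 1)
        nlinarith
    · refine (aux_antitone hV hm h0 q le_rfl ht).trans ?_
      rw [hm0]
      have := (hu (.inr q)).trans (le_max_left u 1)
      nlinarith
  have hnorm : ‖m t‖ < R := by
    refine (pi_norm_lt_iff (by nlinarith)).2 fun b => ?_
    have h1 := mem_multipliers hV hm h0 ht b
    rw [Real.norm_of_nonneg (by linarith)]
    linarith [hub b]
  filter_upwards [continuous_norm.continuousAt.eventually_lt_const hnorm] with y hy
  exact if_pos hy

end Trajectory

end GateParams

namespace GateParams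

variable {N : ℕ} {D : NORNetwork N} {P : GateParams D} {m : ℝ → GateBidder N → ℝ} {k : Fin N}
  {ε : ℝ}

/-! ### Convergence of the auxiliary bidders -/

theorem exists_aux_limit (hm : IsSolution P.system.utility m)
    (h0 : m 0 ∈ multipliers (GateBidder N)) (q : Fin N × ReservedItem × Fin 2) :
    ∃ l, 1 ≤ l ∧ (∀ t, 0 ≤ t → l ≤ m t (.inr q)) ∧
      Tendsto (fun t => m t (.inr q)) atTop (𝓝 l) := by
  have hU := IsTruncation.refl P.system.utility
  have hanti : Antitone fun t : ℝ => m (max t 0) (.inr q) := fun s t hst =>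
    aux_antitone hU hm h0 q (le_max_right _ _) (max_le_max_right 0 hst)
  have hbdd : BddBelow (Set.range fun t : ℝ => m (max t 0) (.inr q)) := by
    refine ⟨1, ?_⟩
    rintro _ ⟨t, rfl⟩
    exact mem_multipliers hU hm h0 (le_max_right _ _) _
  refine ⟨⨅ t : ℝ, m (max t 0) (.inr q), ?_, fun t ht => ?_, ?_⟩
  · exact le_ciInf fun t => mem_multipliers hU hm h0 (le_max_right _ _) _
  · refine (ciInf_le hbdd t).trans_eq ?_
    rw [max_eq_left ht]
  · refine (tendsto_atTop_ciInf hanti hbdd).congr' ?_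
    filter_upwards [eventually_ge_atTop 0] with t ht
    rw [max_eq_left ht]

/-- The two auxiliary bidders of an item cannot both stay away from `1`. -/
theorem not_forall_lt_aux (hm : IsSolution P.system.utility m)
    (h0 : m 0 ∈ multipliers (GateBidder N)) {η : ℝ} (hη : 0 < η) (r : ReservedItem) :
    ¬ ∀ t, 0 ≤ t → ∀ s, 1 + η < m t (.inr (k, r, s)) := by
  intro h
  have hU := IsTruncation.refl P.system.utility
  have hcard : (0 : ℝ) < 1 / (Fintype.card (GateBidder N) : ℝ) := by
    have : 0 < Fintype.card (GateBidder N) := Fintype.card_pos_iff.2 ⟨.inl k⟩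
    positivity
  set c := η * (1 / (Fintype.card (GateBidder N) : ℝ)) with hc
  have hc0 : 0 < c := mul_pos hη hcard
  let φ : (GateBidder N → ℝ) →L[ℝ] ℝ :=
    ContinuousLinearMap.proj (.inr (k, r, 0)) + ContinuousLinearMap.proj (.inr (k, r, 1))
  have hφ : ∀ y, φ y = y (.inr (k, r, 0)) + y (.inr (k, r, 1)) := fun y => rfl
  set t := φ (m 0) / c with ht
  have hφ0 : 0 ≤ φ (m 0) := by
    rw [hφ]
    linarith [h0 (.inr (k, r, 0)), h0 (.inr (k, r, 1))]
  have ht0 : 0 ≤ t := div_nonneg hφ0 hc0.le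
  have h1 := hm.drift φ (c := -c) le_rfl ht0 fun τ hτ g hg => by
    have := filippov_aux_add_le (mem_multipliers hU hm h0 hτ.1.le) hη.le (h τ hτ.1.le) hg
    rw [hφ, hc]
    linarith
  have h2 : -c * (t - 0) = -φ (m 0) := by
    rw [ht]
    field_simp
    ring
  have h3 : 2 < φ (m t) := by
    rw [hφ]
    linarith [h t ht0 0, h t ht0 1]
  linarith

/-- While its rival stays above, an auxiliary bidder does not approach `1`. -/
theorem aux_limit_ne_one (hm : IsSolution P.system.utility m)
    (h0 : m 0 ∈ multipliers (GateBidder N)) {r : ReservedItem} {s s' : Fin 2}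
    (h0s : m 0 (.inr (k, r, s)) ≠ 1) {l : ℝ} (hl : 1 < l)
    (hs' : ∀ t, 0 ≤ t → l ≤ m t (.inr (k, r, s')))
    (hs : Tendsto (fun t => m t (.inr (k, r, s))) atTop (𝓝 1)) : False := by
  have hU := IsTruncation.refl P.system.utility
  have h1 : 1 < m 0 (.inr (k, r, s)) := lt_of_le_of_ne (h0 _) (Ne.symm h0s)
  obtain ⟨v, hv1, hv⟩ := exists_between (lt_min hl h1)
  obtain ⟨T, hT, hT0⟩ :=
    ((hs.eventually_lt_const hv1).and (eventually_ge_atTop 0)).exists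
  obtain ⟨t₁, ht₁, hvt⟩ := intermediate_value_Icc' hT0
    ((hm.continuousOn_apply (.inr (k, r, s))).mono Set.Icc_subset_Ici_self)
    ⟨hT.le, (hv.trans_le (min_le_right _ _)).le⟩
  have h2 : ∀ t, t₁ ≤ t → v ≤ m t (.inr (k, r, s)) := by
    intro t ht
    have := hm.le_drift (.inr (k, r, s)) (c := 0) ht₁.1 ht fun τ hτ g hg => by
      have hτ0 := ht₁.1.trans hτ.1.le
      refine filippov_aux_nonneg (s' := s') (mem_multipliers hU hm h0 hτ0) ?_ hg
      have h3 := aux_antitone hU hm h0 (k, r, s) ht₁.1 hτ.1.le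
      have h4 : v < l := hv.trans_le (min_le_left _ _)
      have h5 := hs' τ hτ0
      simp only at hvt
      linarith
    simp only at hvt
    linarith
  have h3 := ge_of_tendsto hs (eventually_atTop.2 ⟨t₁, h2⟩)
  linarith

theorem tendsto_aux (hm : IsSolution P.system.utility m)
    (h0 : m 0 ∈ multipliers (GateBidder N)) (hne : ∀ b, m 0 b ≠ 1)
    (q : Fin N × ReservedItem × Fin 2) : Tendsto (fun t => m t (.inr q)) atTop (𝓝 1) := by
  obtain ⟨k, r, s⟩ := q
  choose l hl1 hle hlim using fun s => exists_aux_limit hm h0 (k, r, s)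
  have hex : ∃ s, l s = 1 := by
    by_contra! h
    have h1 : ∀ s, 1 < l s := fun s => lt_of_le_of_ne (hl1 s) (Ne.symm (h s))
    obtain ⟨v, hv1, hv⟩ := exists_between (lt_min (h1 0) (h1 1))
    refine not_forall_lt_aux hm h0 (k := k) (r := r) (η := v - 1) (by linarith) fun t ht s => ?_
    have : v < l s := by
      fin_cases s
      · exact hv.trans_le (min_le_left _ _)
      · exact hv.trans_le (min_le_right _ _)
    linarith [hle s t ht]
  obtain ⟨s₀, hs₀⟩ := hex
  have key : l s = 1 := by
    by_contra h
    have h1 : 1 < l s := lt_of_le_of_ne (hl1 s) (Ne.symm h)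
    exact aux_limit_ne_one hm h0 (hne _) h1 (hle s) (hs₀ ▸ hlim s₀)
  exact key ▸ hlim s

theorem tendsto_auxMax (hm : IsSolution P.system.utility m)
    (h0 : m 0 ∈ multipliers (GateBidder N)) (hne : ∀ b, m 0 b ≠ 1) (k : Fin N)
    (r : ReservedItem) : Tendsto (fun t => auxMax (m t) k r) atTop (𝓝 1) := by
  have := (tendsto_aux hm h0 hne (k, r, 0)).max (tendsto_aux hm h0 hne (k, r, 1))
  rwa [max_self] at this

theorem eventually_auxMax_lt_of_solution (hm : IsSolution P.system.utility m)
    (h0 : m 0 ∈ multipliers (GateBidder N)) (hne : ∀ b, m 0 b ≠ 1) (k : Fin N) {c : ℝ}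
    (hc : 1 < c) : ∀ᶠ t in atTop, ∀ r, auxMax (m t) k r < c :=
  eventually_all.2 fun r => (tendsto_auxMax hm h0 hne k r).eventually_lt_const hc

/-! ### Convergence of the variable bidders -/

theorem eventually_le_high (hD : ∀ k, k ∉ D.inputs k) (hm : IsSolution P.system.utility m)
    (h0 : m 0 ∈ multipliers (GateBidder N)) (hne : ∀ b, m 0 b ≠ 1) {u : ℝ} (hu : P.high < u) :
    ∀ᶠ t in atTop, m t (.inl k) ≤ u := by
  have hU := IsTruncation.refl P.system.utility
  have hh := P.one_lt_high
  refine hm.eventually_le (half_pos (P.slack_pos k)) ?_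
  filter_upwards [eventually_auxMax_lt_of_solution hm h0 hne k
    ((one_lt_div (by linarith)).2 hu), eventually_ge_atTop 0] with t hA ht hlt g hg
  refine filippov_le_of_ceiling_lt hD (mem_multipliers hU hm h0 ht) ?_ hg
  have := (lt_div_iff₀ (by linarith)).1 (hA .ceiling)
  linarith

theorem tendsto_inl (hD : ∀ k, k ∉ D.inputs k) (hm : IsSolution P.system.utility m)
    (h0 : m 0 ∈ multipliers (GateBidder N)) (hne : ∀ b, m 0 b ≠ 1) {Y : Fin N → Bool}
    (hY : D.toBooleanNetwork.Satisfies Y)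
    (hin : ∀ j ∈ D.inputs k, Tendsto (fun t => m t (.inl j)) atTop (𝓝 (P.encode Y (.inl j)))) :
    Tendsto (fun t => m t (.inl k)) atTop (𝓝 (P.encode Y (.inl k))) := by
  have hU := IsTruncation.refl P.system.utility
  obtain ⟨ε, hε⟩ := P.exists_isTolerance
  have hmem : ∀ᶠ t in atTop, m t ∈ multipliers (GateBidder N) := by
    filter_upwards [eventually_ge_atTop 0] with t ht using mem_multipliers hU hm h0 ht
  have hA : ∀ᶠ t in atTop, ∀ r, auxMax (m t) k r < 1 + ε :=
    eventually_auxMax_lt_of_solution hm h0 hne k (by linarith [hε.pos])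
  have hlow := P.one_lt_low
  have hthr := P.low_lt_threshold
  have hhigh := P.threshold_lt_high
  have hYk : Y k = decide (∀ j ∈ D.inputs k, Y j = false) := hY k
  cases hk : Y k
  · rw [hk, eq_comm, decide_eq_false_iff_not] at hYk
    push Not at hYk
    obtain ⟨j, hj, hYj⟩ := hYk
    rw [ne_eq, Bool.not_eq_false] at hYj
    have hjlim := hin j hj
    simp only [encode, hYj, hk, Bool.false_eq_true, reduceIte] at hjlim ⊢
    have hlower : ∀ᶠ t in atTop, P.low ≤ m t (.inl k) := by
      refine hm.eventually_ge hε.above_low ?_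
      have hall : ∀ᶠ t in atTop, ∀ j, m t (.inl j) ≤ (3 * P.high + P.low * P.threshold) / 4 :=
        eventually_all.2 fun j => eventually_le_high hD hm h0 hne (by linarith [P.high_lt])
      filter_upwards [hmem, hA, hall] with t h1 h2 h3 hlt g hg
      exact le_filippov_of_lt_low hD hε h1 h2
        (fun j _ => (h3 j).trans_lt (by linarith [P.high_lt])) hlt hg
    refine tendsto_order.2 ⟨fun u hu => ?_, fun u hu => ?_⟩
    · filter_upwards [hlower] with t ht using hu.trans_le ht
    · obtain ⟨v, hv, hvu⟩ := exists_between hu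
      have : ∀ᶠ t in atTop, m t (.inl k) ≤ v := by
        refine hm.eventually_le (neg_pos.2 hε.turn_low) ?_
        filter_upwards [hmem, hA, eventually_auxMax_lt_of_solution hm h0 hne k
          ((one_lt_div (by linarith)).2 hv),
          hjlim.eventually_const_lt (by linarith : (P.threshold + P.high) / 2 < P.high)]
          with t h1 h2 h3 h4 hlt g hg
        rw [neg_neg]
        refine filippov_le_of_input hD hε h1 hj h4 (h2 .E) ?_ hg
        have := (lt_div_iff₀ (by linarith)).1 (h3 .H)
        linarith
      filter_upwards [this] with t ht using ht.trans_lt hvu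
  · rw [hk, eq_comm, decide_eq_true_iff] at hYk
    simp only [encode, hk, reduceIte]
    have hlower : ∀ᶠ t in atTop, P.high ≤ m t (.inl k) := by
      refine hm.eventually_ge hε.turn_high ?_
      have hall : ∀ᶠ t in atTop, ∀ j ∈ D.inputs k, m t (.inl j) < (P.low + P.threshold) / 2 := by
        refine (Finset.eventually_all (D.inputs k)).2 fun j hj => ?_
        have := hin j hj
        simp only [encode, hYk j hj, Bool.false_eq_true, reduceIte] at this
        exact this.eventually_lt_const (by linarith)
      filter_upwards [hmem, hA, hall] with t h1 h2 h3 hlt g hg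
      exact le_filippov_of_inputs_low hD hε h1 h2 h3 hlt hg
    refine tendsto_order.2 ⟨fun u hu => ?_, fun u hu => ?_⟩
    · filter_upwards [hlower] with t ht using hu.trans_le ht
    · obtain ⟨v, hv, hvu⟩ := exists_between hu
      filter_upwards [eventually_le_high hD hm h0 hne hv] with t ht using ht.trans_lt hvu

/-- Solutions that start off the boundary converge to the encoding of the satisfying assignment. -/
theorem tendsto_encode (hD : ∀ k, ∀ j ∈ D.inputs k, j < k) (hm : IsSolution P.system.utility m)
    (h0 : m 0 ∈ multipliers (GateBidder N)) (hne : ∀ b, m 0 b ≠ 1) {Y : Fin N → Bool}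
    (hY : D.toBooleanNetwork.Satisfies Y) : Tendsto m atTop (𝓝 (P.encode Y)) := by
  have hD' : ∀ k, k ∉ D.inputs k := fun k hk => lt_irrefl k (hD k k hk)
  refine tendsto_pi_nhds.2 ?_
  rintro (k | q)
  · induction k using WellFoundedLT.induction with
    | ind k ih => exact tendsto_inl hD' hm h0 hne hY fun j hj => ih j (hD k j hj)
  · exact tendsto_aux hm h0 hne q

theorem isEquilibrium_encode (hD : ∀ k, ∀ j ∈ D.inputs k, j < k) {Y : Fin N → Bool}
    (hY : D.toBooleanNetwork.Satisfies Y) : IsEquilibrium P.system.utility (P.encode Y) := by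
  have hD' : ∀ k, k ∉ D.inputs k := fun k hk => lt_irrefl k (hD k k hk)
  have h2 : (fun _ => 2) ∈ multipliers (GateBidder N) := fun _ => one_le_two
  obtain ⟨m, hm, hm0⟩ := P.exists_isSolution hD' h2
  refine hm.isEquilibrium_of_tendsto (tendsto_encode hD hm (hm0 ▸ h2) (fun b => ?_) hY)
  rw [hm0]
  norm_num

/-! ### Stability -/

theorem inl_mem_Icc (hD : ∀ k, k ∉ D.inputs k) (hε : P.IsTolerance ε)
    (hm : IsSolution P.system.utility m) (h0 : m 0 ∈ multipliers (GateBidder N)) {Y : Fin N → Bool}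
    (hY : D.toBooleanNetwork.Satisfies Y) {δ : ℝ} (hδ : 0 < δ) (hδε : δ < ε)
    (h1 : δ < (P.high - P.threshold) / 2) (h2 : P.high * δ < (P.threshold - P.low) / 2)
    (h3 : P.high * δ < (P.low * P.threshold - P.high) / 2)
    (hstart : m 0 ∈ Metric.ball (P.encode Y) δ)
    (hin : ∀ j ∈ D.inputs k, ∀ t, 0 ≤ t →
      m t (.inl j) ∈ Set.Icc (P.encode Y (.inl j) - δ) (P.encode Y (.inl j) + P.high * δ))
    {t : ℝ} (ht : 0 ≤ t) :
    m t (.inl k) ∈ Set.Icc (P.encode Y (.inl k) - δ) (P.encode Y (.inl k) + P.high * δ) := by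
  have hU := IsTruncation.refl P.system.utility
  have hlow := P.one_lt_low
  have hthr := P.low_lt_threshold
  have hhigh := P.threshold_lt_high
  have hstart' : ∀ b, |m 0 b - P.encode Y b| < δ := fun b =>
    (dist_pi_lt_iff hδ).1 hstart b
  have hmem : ∀ t, 0 ≤ t → m t ∈ multipliers (GateBidder N) := fun t ht =>
    mem_multipliers hU hm h0 ht
  have hA0 : ∀ r, auxMax (m 0) k r ≤ 1 + δ := fun r => by
    have h4 : ∀ s, m 0 (.inr (k, r, s)) ≤ 1 + δ := fun s => by
      have h5 := (abs_lt.1 (hstart' (.inr (k, r, s)))).2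
      simp only [encode] at h5
      linarith
    exact max_le (h4 0) (h4 1)
  have hA : ∀ t, 0 ≤ t → ∀ r, auxMax (m t) k r ≤ 1 + δ := fun t ht r =>
    (auxMax_antitone hU hm h0 k r le_rfl ht).trans (hA0 r)
  have hAε : ∀ t, 0 ≤ t → ∀ r, auxMax (m t) k r < 1 + ε := fun t ht r => by
    linarith [hA t ht r]
  have hk0 := abs_lt.1 (hstart' (.inl k))
  have hδh : δ ≤ P.high * δ := by nlinarith
  have hYk : Y k = decide (∀ j ∈ D.inputs k, Y j = false) := hY k
  cases hk : Y k
  · rw [hk, eq_comm, decide_eq_false_iff_not] at hYk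
    push Not at hYk
    obtain ⟨j, hj, hYj⟩ := hYk
    rw [ne_eq, Bool.not_eq_false] at hYj
    have hjt := hin j hj
    simp only [encode, hYj, hk, Bool.false_eq_true, reduceIte] at hjt hk0 ⊢
    constructor
    · refine hm.ge_of_drift_nonneg (fun t ht hlt g hg => ?_) (by linarith) ht
      refine hε.above_low.le.trans (le_filippov_of_lt_low hD hε (hmem t ht) (hAε t ht) ?_
        (by linarith) hg)
      intro i hi
      have h4 := (hin i hi t ht).2
      have h5 : P.encode Y (.inl i) ≤ P.high := by
        simp only [encode]
        split_ifs <;> linarith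
      linarith
    · refine hm.le_of_drift_nonpos (fun t ht hlt g hg => ?_) (by linarith) ht
      refine (filippov_le_of_input hD hε (hmem t ht) hj ?_ (hAε t ht .E) ?_ hg).trans
        hε.turn_low.le
      · linarith [(hjt t ht).1]
      · nlinarith [hA t ht .H]
  · rw [hk, eq_comm, decide_eq_true_iff] at hYk
    simp only [encode, hk, reduceIte] at hk0 ⊢
    constructor
    · refine hm.ge_of_drift_nonneg (fun t ht hlt g hg => ?_) (by linarith) ht
      refine hε.turn_high.le.trans (le_filippov_of_inputs_low hD hε (hmem t ht) (hAε t ht) ?_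
        (by linarith) hg)
      intro i hi
      have h4 := (hin i hi t ht).2
      simp only [encode, hYk i hi, Bool.false_eq_true, reduceIte] at h4
      linarith
    · refine hm.le_of_drift_nonpos (fun t ht hlt g hg => ?_) (by linarith) ht
      have h4 := filippov_le_of_ceiling_lt hD (hmem t ht)
        (by nlinarith [hA t ht .ceiling]) hg
      linarith [P.slack_pos k]

theorem isLocallyStable_encode (hD : ∀ k, ∀ j ∈ D.inputs k, j < k) {Y : Fin N → Bool}
    (hY : D.toBooleanNetwork.Satisfies Y) : IsLocallyStable P.system.utility (P.encode Y) := by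
  have hD' : ∀ k, k ∉ D.inputs k := fun k hk => lt_irrefl k (hD k k hk)
  have hU := IsTruncation.refl P.system.utility
  refine ⟨isEquilibrium_encode hD hY, fun ε₀ hε₀ => ?_, 1, one_pos, ?_⟩
  · obtain ⟨ε, hε⟩ := P.exists_isTolerance
    have hlow := P.one_lt_low
    have hthr := P.low_lt_threshold
    have hhigh := P.threshold_lt_high
    have ev : ∀ {f : ℝ → ℝ} {c : ℝ}, Continuous f → f 0 < c → ∀ᶠ δ in 𝓝[>] 0, f δ < c :=
      fun hf h => ((hf.tendsto 0).eventually_lt_const h).filter_mono nhdsWithin_le_nhds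
    have e1 : ∀ᶠ δ in 𝓝[>] (0 : ℝ), δ < ε := ev continuous_id hε.pos
    have e2 : ∀ᶠ δ in 𝓝[>] (0 : ℝ), δ < (P.high - P.threshold) / 2 :=
      ev continuous_id (by linarith)
    have e3 : ∀ᶠ δ in 𝓝[>] (0 : ℝ), P.high * δ < (P.threshold - P.low) / 2 :=
      ev (by fun_prop) (by linarith)
    have e4 : ∀ᶠ δ in 𝓝[>] (0 : ℝ), P.high * δ < (P.low * P.threshold - P.high) / 2 :=
      ev (by fun_prop) (by linarith [P.high_lt])
    have e5 : ∀ᶠ δ in 𝓝[>] (0 : ℝ), P.high * δ < ε₀ := ev (by fun_prop) (by linarith)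
    obtain ⟨δ, hδ, h1, h2, h3, h4, h5⟩ := (eventually_mem_nhdsWithin.and
      (e1.and (e2.and (e3.and (e4.and e5))))).exists
    have hδ0 : 0 < δ := hδ
    have hδh : δ ≤ P.high * δ := by nlinarith
    refine ⟨δ, hδ, fun m hm ⟨hstart, h0⟩ t ht => (dist_pi_lt_iff hε₀).2 ?_⟩
    rintro (k | q)
    · have key : ∀ t, 0 ≤ t → m t (.inl k) ∈
          Set.Icc (P.encode Y (.inl k) - δ) (P.encode Y (.inl k) + P.high * δ) := by
        induction k using WellFoundedLT.induction with
        | ind k ih =>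
          intro t ht
          exact inl_mem_Icc hD' hε hm h0 hY hδ0 h1 h2 h3 h4 hstart
            (fun j hj => ih j (hD k j hj)) ht
      have h6 := key t ht
      rw [Real.dist_eq, abs_lt]
      constructor <;> linarith [h6.1, h6.2]
    · have h6 := aux_antitone hU hm h0 q le_rfl ht
      have h7 := mem_multipliers hU hm h0 ht (.inr q)
      have h8 := (abs_lt.1 ((dist_pi_lt_iff hδ0).1 hstart (.inr q))).2
      rw [Real.dist_eq, abs_lt]
      simp only [encode] at h8 ⊢
      constructor <;> linarith
  · filter_upwards [ae_forall_ne 1] with x hx hmem m hm hm0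
    exact tendsto_encode hD hm (hm0 ▸ hmem.2) (hm0 ▸ hx) hY

/-- A locally stable equilibrium attracts almost all nearby points, so it must be the point to
which almost all solutions converge. -/
theorem eq_encode_of_isLocallyStable (hD : ∀ k, ∀ j ∈ D.inputs k, j < k) {Y : Fin N → Bool}
    (hY : D.toBooleanNetwork.Satisfies Y) {p : GateBidder N → ℝ}
    (hp : p ∈ multipliers (GateBidder N)) (hs : IsLocallyStable P.system.utility p) :
    p = P.encode Y := by
  have hD' : ∀ k, k ∉ D.inputs k := fun k hk => lt_irrefl k (hD k k hk)
  obtain ⟨-, -, δ, hδ, hconv⟩ := hs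
  let q : GateBidder N → ℝ := fun b => p b + δ / 2
  have hsub : Metric.ball q (δ / 2) ⊆ Metric.ball p δ ∩ multipliers (GateBidder N) := by
    intro x hx
    have hx' : ∀ b, |x b - (p b + δ / 2)| < δ / 2 := (dist_pi_lt_iff (half_pos hδ)).1 hx
    refine ⟨(dist_pi_lt_iff hδ).2 fun b => ?_, fun b => ?_⟩
    · have := abs_lt.1 (hx' b)
      rw [Real.dist_eq, abs_lt]
      constructor <;> linarith
    · have := abs_lt.1 (hx' b)
      linarith [hp b]
  have hpos : volume (Metric.ball q (δ / 2)) ≠ 0 :=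
    (Metric.measure_ball_pos volume q (half_pos hδ)).ne'
  obtain ⟨x, hx, hxc, hxne⟩ :=
    ((frequently_ae_mem_iff.2 hpos).and_eventually (hconv.and (ae_forall_ne 1))).exists
  obtain ⟨m, hm, hm0⟩ := P.exists_isSolution hD' (hsub hx).2
  exact tendsto_nhds_unique (hxc (hsub hx) m hm hm0)
    (tendsto_encode hD hm (hm0 ▸ (hsub hx).2) (hm0 ▸ hxne) hY)

theorem isCoordinatewiseStable_encode (hD : ∀ k, ∀ j ∈ D.inputs k, j < k) {Y : Fin N → Bool}
    (hY : D.toBooleanNetwork.Satisfies Y) :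
    IsCoordinatewiseStable P.system.utility (Set.range Sum.inl) (P.encode Y) := by
  have hD' : ∀ k, k ∉ D.inputs k := fun k hk => lt_irrefl k (hD k k hk)
  refine ⟨isEquilibrium_encode hD hY, ?_⟩
  obtain ⟨ε, hε⟩ := P.exists_isTolerance
  have hlow := P.one_lt_low
  have hthr := P.low_lt_threshold
  have hhigh := P.threshold_lt_high
  have hfl := P.floor_lt_low
  obtain ⟨δ, hδ, h1⟩ : ∃ δ > 0, δ < min (min ((P.high - P.threshold) / 2)
      ((P.threshold - P.low) / 2)) ((P.low * P.threshold - P.high) / 2) := by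
    obtain ⟨δ, h1, h2⟩ := exists_between (lt_min (lt_min
      (by linarith : 0 < (P.high - P.threshold) / 2) (by linarith : 0 < (P.threshold - P.low) / 2))
      (by linarith [P.high_lt] : 0 < (P.low * P.threshold - P.high) / 2))
    exact ⟨δ, h1, h2⟩
  rw [lt_min_iff, lt_min_iff] at h1
  obtain ⟨⟨hδ1, hδ2⟩, hδ3⟩ := h1
  refine ⟨δ, hδ, Eventually.of_forall fun z ⟨hz, hz1⟩ => ?_⟩
  classical
  set x : GateBidder N → ℝ := fun b =>
    if h : b ∈ Set.range Sum.inl then z ⟨b, h⟩ else P.encode Y b with hx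
  have hxinl : ∀ k : Fin N, x (.inl k) = z ⟨.inl k, k, rfl⟩ := fun k => by simp [hx]
  have hxinr : ∀ q, x (.inr q) = 1 := fun q => by simp [hx, encode]
  have hclose : ∀ k : Fin N, |x (.inl k) - P.encode Y (.inl k)| < δ := fun k => by
    rw [hxinl]
    exact abs_sub_lt_of_mem_ball hz ⟨.inl k, k, rfl⟩
  have hxm : x ∈ multipliers (GateBidder N) := by
    rintro (k | q)
    · rw [hxinl]
      exact hz1 _
    · rw [hxinr]
  have hx1 : ∀ b, 1 - ε < x b := fun b => by linarith [hxm b, hε.pos]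
  have hx0 : ∀ b, 0 < x b := fun b => by linarith [hxm b]
  have hA : ∀ k r, auxMax x k r = 1 := fun k r => by simp [auxMax, hxinr]
  have hA' : ∀ k r, auxMax x k r < 1 + ε := fun k r => by linarith [hA k r, hε.pos]
  rintro ⟨_, k, rfl⟩
  have hkc := abs_lt.1 (hclose k)
  have hYk : Y k = decide (∀ j ∈ D.inputs k, Y j = false) := hY k
  have main : (x (.inl k) < P.encode Y (.inl k) → 0 < P.system.utility x (.inl k)) ∧
      (P.encode Y (.inl k) < x (.inl k) → P.system.utility x (.inl k) < 0) := by
    cases hk : Y k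
    · rw [hk, eq_comm, decide_eq_false_iff_not] at hYk
      push Not at hYk
      obtain ⟨j, hj, hYj⟩ := hYk
      rw [ne_eq, Bool.not_eq_false] at hYj
      have hjc := abs_lt.1 (hclose j)
      simp only [encode, hYj, hk, Bool.false_eq_true, reduceIte] at hjc hkc ⊢
      refine ⟨fun hlt => ?_, fun hlt => ?_⟩
      · refine hε.above_low.trans_le (le_utility_of_lt_low hD' hε hx1 (hA' k) ?_
          (by rw [hA]; linarith) (by rw [hA]; linarith))
        intro i _
        have h4 := (abs_lt.1 (hclose i)).2
        have h5 : P.encode Y (.inl i) ≤ P.high := by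
          simp only [encode]
          split_ifs <;> linarith
        linarith
      · refine (utility_le_of_input hD' hε hx1 hj (by linarith) (by rw [hA]; linarith)
          (by rw [hA]; linarith)).trans_lt hε.turn_low
    · rw [hk, eq_comm, decide_eq_true_iff] at hYk
      simp only [encode, hk, reduceIte] at hkc ⊢
      refine ⟨fun hlt => ?_, fun hlt => ?_⟩
      · refine hε.turn_high.trans_le (le_utility_of_inputs_low hD' hε hx1 (hA' k) ?_
          (by rw [hA]; linarith))
        intro i hi
        have h4 := (abs_lt.1 (hclose i)).2
        simp only [encode, hYk i hi, Bool.false_eq_true, reduceIte] at h4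
        linarith
      · have h4 := utility_le_of_ceiling_lt (P := P) hD' hx0 (by rw [hA]; linarith)
        rw [hA, sub_self, mul_zero] at h4
        linarith [P.slack_pos k]
  rw [hxinl] at main
  convert main using 3 <;> (congr! 2; simp only [hx]; split_ifs <;> rfl)

end GateParams

/-! ### Acyclic networks -/

theorem NORNetwork.lt_of_mem_inputs {N : ℕ} {D : NORNetwork N} (hD : D.toBooleanNetwork.Acyclic)
    (k j : Fin N) (hj : j ∈ D.inputs k) : j < k := by
  by_contra! hle
  have h := hD k (fun _ => false) (fun i => decide (i = j)) fun i hi => by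
    simp [(hi.trans_le hle).ne]
  have h1 : ¬ ∀ i ∈ D.inputs k, decide (i = j) = false := fun h => by simpa using h j hj
  simp only [NORNetwork.toBooleanNetwork, h1] at h
  simp at h

theorem BooleanNetwork.Acyclic.eq_of_satisfies {n : ℕ} {C : BooleanNetwork n} (hC : C.Acyclic)
    {X Y : Fin n → Bool} (hX : C.Satisfies X) (hY : C.Satisfies Y) : X = Y := by
  funext i
  induction i using WellFoundedLT.induction with
  | ind i ih => rw [hX i, hY i, hC i X Y ih]

theorem BooleanNetwork.Acyclic.exists_satisfies {n : ℕ} {C : BooleanNetwork n}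
    (hC : C.Acyclic) : ∃ X, C.Satisfies X := by
  have key : ∀ k : ℕ, ∃ X : Fin n → Bool, ∀ i : Fin n, (i : ℕ) < k → X i = C.f i X := by
    intro k
    induction k with
    | zero => exact ⟨fun _ => false, fun i hi => absurd hi (Nat.not_lt_zero _)⟩
    | succ k ih =>
      obtain ⟨X, hX⟩ := ih
      refine ⟨fun i => if (i : ℕ) < k then X i else C.f i X, fun i hi => ?_⟩
      have h : C.f i X = C.f i fun j : Fin n => if (j : ℕ) < k then X j else C.f j X :=
        hC i _ _ fun j hj => (if_pos (by have : (j : ℕ) < i := hj; omega)).symm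
      rw [← h]
      change (if (i : ℕ) < k then X i else C.f i X) = C.f i X
      split_ifs with hik
      · exact hX i hik
      · rfl
  obtain ⟨X, hX⟩ := key n
  exact ⟨X, fun i => hX i i.2⟩

/-! ### From circuits to networks -/

theorem Fintype.exists_equiv_fin_lt {G R : Type} [Fintype G] [LinearOrder R] (rank : G → R) :
    ∃ σ : G ≃ Fin (Fintype.card G), ∀ a b, rank a < rank b → σ a < σ b := by
  classical
  let key : G → R ×ₗ Fin (Fintype.card G) := fun g => toLex (rank g, Fintype.equivFin G g)
  have hkey : Function.Injective key := fun a b h => by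
    have := congrArg (fun p => (ofLex p).2) h
    simpa [key] using this
  let _ : LinearOrder G := LinearOrder.lift' key hkey
  refine ⟨(Fintype.orderIsoFinOfCardEq G rfl).symm.toEquiv, fun a b hab => ?_⟩
  have h : a < b := by
    change key a < key b
    exact Prod.Lex.toLex_lt_toLex.2 (Or.inl hab)
  exact (Fintype.orderIsoFinOfCardEq G rfl).symm.lt_iff_lt.2 h

/-- A circuit of NOR gates, given by the ranks of its gates and their values on each assignment of
the distinguished gates, yields an acyclic NOR network. -/
theorem exists_norNetwork_of_circuit {n : ℕ} (C : BooleanNetwork n) {G R : Type} [Fintype G]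
    [LinearOrder R] (rank : G → R) (inputs : G → Finset G) (mark : Fin n ↪ G)
    (val : (Fin n → Bool) → G → Bool)
    (hrank : ∀ g, ∀ j ∈ inputs g, rank j < rank g) (hcard : ∀ g, (inputs g).card ≤ 2)
    (hmark : ∀ X i, val X (mark i) = X i)
    (hval : ∀ X g, g ∉ Set.range mark → val X g = decide (∀ j ∈ inputs g, val X j = false))
    (hout : ∀ X i, decide (∀ j ∈ inputs (mark i), val X j = false) = C.f i X) :
    ∃ (N : ℕ) (e : Fin n ↪ Fin N) (D : NORNetwork N),
      D.toBooleanNetwork.Acyclic ∧ D.Implements e C ∧ ∀ i, (D.inputs i).card ≤ 2 := by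
  obtain ⟨σ, hσ⟩ := Fintype.exists_equiv_fin_lt rank
  let D : NORNetwork (Fintype.card G) := ⟨fun i => (inputs (σ.symm i)).map σ.toEmbedding⟩
  have hmem : ∀ i j, j ∈ D.inputs i ↔ σ.symm j ∈ inputs (σ.symm i) := fun i j => by
    simp only [D, Finset.mem_map_equiv]
  have hlt : ∀ i, ∀ j ∈ D.inputs i, j < i := fun i j hj => by
    have := hσ _ _ (hrank _ _ ((hmem i j).1 hj))
    simpa using this
  have hac : D.toBooleanNetwork.Acyclic := fun i X Y h => by
    simp only [NORNetwork.toBooleanNetwork]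
    congr 1
    refine propext (forall₂_congr fun j hj => ?_)
    rw [h j (hlt i j hj)]
  have hf : ∀ X i, D.toBooleanNetwork.f i (fun k => val X (σ.symm k)) =
      decide (∀ j ∈ inputs (σ.symm i), val X j = false) := fun X i => by
    simp only [NORNetwork.toBooleanNetwork]
    congr 1
    refine propext ⟨fun h j hj => ?_, fun h j hj => h _ ((hmem i j).1 hj)⟩
    have := h (σ j) ((hmem i _).2 (by simpa using hj))
    simpa using this
  let e : Fin n ↪ Fin (Fintype.card G) := mark.trans σ.toEmbedding
  have he : ∀ i, e i = σ (mark i) := fun i => rfl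
  have hext : ∀ X, D.IsExtension e X fun k => val X (σ.symm k) := fun X => by
    refine ⟨fun i => by simp [he, hmark], fun g hg => ?_⟩
    rw [hf]
    refine hval X _ ?_
    rintro ⟨i, hi⟩
    exact hg ⟨i, by rw [he, hi, σ.apply_symm_apply]⟩
  have huniq : ∀ X Y Z, D.IsExtension e X Y → D.IsExtension e X Z → Y = Z := by
    intro X Y Z hY hZ
    funext k
    induction k using WellFoundedLT.induction with
    | ind k ih =>
      by_cases hk : k ∈ Set.range e
      · obtain ⟨i, rfl⟩ := hk
        rw [hY.1, hZ.1]
      · rw [hY.2 k hk, hZ.2 k hk, hac k Y Z ih]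
  refine ⟨_, e, D, hac, fun X => ⟨⟨_, hext X, fun Y hY => huniq X _ _ hY (hext X)⟩,
    fun Y hY i => ?_⟩, fun i => by simpa [D] using hcard _⟩
  rw [huniq X _ _ hY (hext X), hf, he, σ.symm_apply_apply, hout]

/-! ### A circuit for an acyclic boolean network -/

/-- The gates of the circuit for a network of size `n`: besides the distinguished gates, their
negations, and a constant, there are gates that evaluate the constraints by Shannon expansion. -/
inductive ShannonGate (n : ℕ)
  | one
  | neg (j : Fin n)
  | const (i : Fin n) (σ : Fin n → Bool)
  | lo (i j : Fin n) (σ : Fin n → Bool)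
  | hi (i j : Fin n) (σ : Fin n → Bool)
  | out (i j : Fin n) (σ : Fin n → Bool)
  | negTop (i : Fin n)
  | top (i : Fin n)
  deriving Fintype

namespace ShannonGate

variable {n : ℕ}

/-- The gate for the function `C.f i` in which the variables from `j` on are fixed by `σ`. -/
def expand (i : Fin n) (j : Fin n) (σ : Fin n → Bool) : ShannonGate n :=
  if (j : ℕ) = 0 then const i σ else out i ⟨j - 1, by omega⟩ σ

/-- The rank of a gate; all gates that belong to `C.f i` come after the variables below `i`. -/
def rank : ShannonGate n → ℕ ×ₗ ℕ
  | one => toLex (0, 0)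
  | neg j => toLex (j, 2 * n + 5)
  | const i _ => toLex (i, 1)
  | lo i j _ => toLex (i, 2 * j + 2)
  | hi i j _ => toLex (i, 2 * j + 2)
  | out i j _ => toLex (i, 2 * j + 3)
  | negTop i => toLex (i, 2 * n + 3)
  | top i => toLex (i, 2 * n + 4)

open Classical in
/-- The inputs of a gate. -/
def inputs (C : BooleanNetwork n) : ShannonGate n → Finset (ShannonGate n)
  | one => ∅
  | neg j => {top j}
  | const i σ => if C.f i σ then ∅ else {one}
  | lo i j σ => if j < i then {top j, expand i j (Function.update σ j false)} else ∅
  | hi i j σ => if j < i then {neg j, expand i j (Function.update σ j true)} else ∅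
  | out i j σ => if j < i then {lo i j σ, hi i j σ} else ∅
  | negTop i => {expand i i fun _ => false}
  | top i => {negTop i}

/-- The value of `C.f i` if the variables from `j` on are fixed by `σ`. -/
def partialValue (C : BooleanNetwork n) (X : Fin n → Bool) (i : Fin n) (j : ℕ)
    (σ : Fin n → Bool) : Bool :=
  C.f i fun l => if (l : ℕ) < j then X l else σ l

/-- The value of a gate on an assignment of the distinguished gates. -/
def val (C : BooleanNetwork n) (X : Fin n → Bool) : ShannonGate n → Bool
  | one => true
  | neg j => !X j
  | const i σ => C.f i σ
  | lo i j σ => if j < i then !X j && !partialValue C X i j (Function.update σ j false) else true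
  | hi i j σ => if j < i then X j && !partialValue C X i j (Function.update σ j true) else true
  | out i j σ => if j < i then partialValue C X i (j + 1) σ else true
  | negTop i => !C.f i X
  | top i => X i

variable {C : BooleanNetwork n} {X : Fin n → Bool}

theorem val_expand {i j : Fin n} (hj : j ≤ i) (σ : Fin n → Bool) :
    val C X (expand i j σ) = partialValue C X i j σ := by
  rw [expand]
  split_ifs with h
  · simp [val, partialValue, h]
  · have h1 : (⟨j - 1, by omega⟩ : Fin n) < i := by
      have : (j : ℕ) ≤ i := hj
      rw [Fin.lt_def]
      simp only
      omega
    have h2 : (j : ℕ) - 1 + 1 = j := by omega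
    simp only [val, if_pos h1, h2]

theorem partialValue_succ (i j : Fin n) (σ : Fin n → Bool) :
    partialValue C X i (j + 1) σ = partialValue C X i j (Function.update σ j (X j)) := by
  rw [partialValue, partialValue]
  congr 1
  funext l
  rcases lt_trichotomy (l : ℕ) j with h | h | h
  · rw [if_pos (by omega), if_pos h]
  · obtain rfl := Fin.ext h
    simp
  · rw [if_neg (by omega), if_neg (by omega), Function.update_of_ne]
    rintro rfl
    exact lt_irrefl _ h

theorem toLex_lt_of {a b c d : ℕ} (h : a < c ∨ a = c ∧ b < d) : toLex (a, b) < toLex (c, d) :=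
  Prod.Lex.toLex_lt_toLex.2 h

theorem rank_expand_lt (i j : Fin n) (σ : Fin n → Bool) :
    rank (expand i j σ) < toLex ((i : ℕ), 2 * (j : ℕ) + 2) := by
  rw [expand]
  split_ifs with h
  · exact toLex_lt_of (a := i) (b := 1) (by omega)
  · exact toLex_lt_of (a := i) (b := 2 * (j - 1) + 3) (by omega)

theorem rank_lt (g : ShannonGate n) : ∀ j ∈ inputs C g, rank j < rank g := by
  classical
  intro a ha
  rcases g with _ | j | ⟨i, σ⟩ | ⟨i, j, σ⟩ | ⟨i, j, σ⟩ | ⟨i, j, σ⟩ | i | i <;>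
    simp only [inputs] at ha
  · simp at ha
  · rw [Finset.mem_singleton] at ha
    subst ha
    exact toLex_lt_of (by omega)
  · split_ifs at ha
    · simp at ha
    · rw [Finset.mem_singleton] at ha
      subst ha
      exact toLex_lt_of (by omega)
  · split_ifs at ha with hji
    · rw [Finset.mem_insert, Finset.mem_singleton] at ha
      rcases ha with rfl | rfl
      · exact toLex_lt_of (by omega)
      · exact rank_expand_lt _ _ _
    · simp at ha
  · split_ifs at ha with hji
    · rw [Finset.mem_insert, Finset.mem_singleton] at ha
      rcases ha with rfl | rfl
      · exact toLex_lt_of (by omega)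
      · exact rank_expand_lt _ _ _
    · simp at ha
  · split_ifs at ha with hji
    · rw [Finset.mem_insert, Finset.mem_singleton] at ha
      rcases ha with rfl | rfl <;> exact toLex_lt_of (by omega)
    · simp at ha
  · rw [Finset.mem_singleton] at ha
    subst ha
    refine (rank_expand_lt _ _ _).trans ?_
    exact toLex_lt_of (by omega)
  · rw [Finset.mem_singleton] at ha
    subst ha
    exact toLex_lt_of (by omega)

theorem card_inputs_le (g : ShannonGate n) : (inputs C g).card ≤ 2 := by
  rcases g with _ | j | ⟨i, σ⟩ | ⟨i, j, σ⟩ | ⟨i, j, σ⟩ | ⟨i, j, σ⟩ | i | i <;>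
    simp only [inputs] <;> (try split_ifs) <;> simp [Finset.card_le_two]

theorem val_eq (hC : C.Acyclic) (g : ShannonGate n) (hg : g ∉ Set.range top) :
    val C X g = decide (∀ j ∈ inputs C g, val C X j = false) := by
  have hneg : ∀ j, val C X (neg j) = !X j := fun _ => rfl
  have htop : ∀ j, val C X (top j) = X j := fun _ => rfl
  have hone : val C X one = true := rfl
  rcases g with _ | j | ⟨i, σ⟩ | ⟨i, j, σ⟩ | ⟨i, j, σ⟩ | ⟨i, j, σ⟩ | i | i
  · simp [inputs, hone]
  · simp [inputs, hneg, htop]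
  · have hval : val C X (const i σ) = C.f i σ := rfl
    by_cases h : C.f i σ <;> simp [inputs, hval, hone, h]
  · by_cases h : j < i
    · have hval : val C X (lo i j σ) = _ := if_pos h
      simp [inputs, hval, h, val_expand h.le, htop]
    · have hval : val C X (lo i j σ) = _ := if_neg h
      simp [inputs, hval, h]
  · by_cases h : j < i
    · have hval : val C X (hi i j σ) = _ := if_pos h
      simp [inputs, hval, h, val_expand h.le, hneg]
    · have hval : val C X (hi i j σ) = _ := if_neg h
      simp [inputs, hval, h]
  · by_cases h : j < i
    · cases hX : X j <;> simp [inputs, val, h, partialValue_succ, hX]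
    · simp [inputs, val, h]
  · have h : partialValue C X i i (fun _ => false) = C.f i X :=
      hC i _ _ fun j hj => if_pos hj
    have hval : val C X (negTop i) = !C.f i X := rfl
    simp [inputs, hval, val_expand le_rfl, h]
  · exact absurd ⟨i, rfl⟩ hg

theorem nor_inputs_top (i : Fin n) :
    decide (∀ j ∈ inputs C (top i), val C X j = false) = C.f i X := by
  have hval : val C X (negTop i) = !C.f i X := rfl
  simp [inputs, hval]

end ShannonGate

theorem BooleanNetwork.Acyclic.exists_norNetwork {n : ℕ} {C : BooleanNetwork n}
    (hC : C.Acyclic) : ∃ (N : ℕ) (e : Fin n ↪ Fin N) (D : NORNetwork N),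
      D.toBooleanNetwork.Acyclic ∧ D.Implements e C ∧ ∀ i, (D.inputs i).card ≤ 2 :=
  exists_norNetwork_of_circuit C ShannonGate.rank (ShannonGate.inputs C)
    ⟨ShannonGate.top, fun _ _ => ShannonGate.top.inj⟩ (ShannonGate.val C)
    ShannonGate.rank_lt ShannonGate.card_inputs_le (fun _ _ => rfl)
    (fun _ => ShannonGate.val_eq hC) fun _ => ShannonGate.nor_inputs_top

theorem GateParams.nonempty {N : ℕ} (D : NORNetwork N) : Nonempty (GateParams D) := by
  refine ⟨⟨1, 2, 3, 4, 1, fun _ => 5 + N, le_rfl, by norm_num, by norm_num, by norm_num,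
    by norm_num, by norm_num, fun i => ?_⟩⟩
  have h : ((Finset.univ.filter fun k => i ∈ D.inputs k).card : ℝ) ≤ N := by
    have := Finset.card_filter_le Finset.univ fun k => i ∈ D.inputs k
    rw [Finset.card_univ, Fintype.card_fin] at this
    exact_mod_cast this
  have hN : (0 : ℝ) ≤ N := Nat.cast_nonneg N
  linarith

end

theorem theorem5 {n : ℕ} (C : BooleanNetwork n) (hC : C.Acyclic) :
    (∃ (N : ℕ) (e : Fin n ↪ Fin N) (D : NORNetwork N),
      D.toBooleanNetwork.Acyclic ∧ D.Implements e C ∧ (∀ i, (D.inputs i).card ≤ 2) ∧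
      Nonempty (GateParams D)) ∧
    ∀ (N : ℕ) (e : Fin n ↪ Fin N) (D : NORNetwork N),
      D.toBooleanNetwork.Acyclic → D.Implements e C → ∀ P : GateParams D,
      ∃ (X : Fin n → Bool) (Y : Fin N → Bool),
        (∀ X', C.Satisfies X' ↔ X' = X) ∧
        (∀ Y', D.toBooleanNetwork.Satisfies Y' ↔ Y' = Y) ∧
        (∀ i, Y (e i) = X i) ∧
        IsLocallyStable P.system.utility (P.encode Y) ∧
        IsCoordinatewiseStable P.system.utility (Set.range Sum.inl) (P.encode Y) ∧
        (∀ p ∈ multipliers (GateBidder N), IsLocallyStable P.system.utility p → p = P.encode Y) ∧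
        ∀ᵐ m₀ : GateBidder N → ℝ, m₀ ∈ multipliers (GateBidder N) →
          (∃ m, IsSolution P.system.utility m ∧ m 0 = m₀) ∧
          ∀ m, IsSolution P.system.utility m → m 0 = m₀ →
            Tendsto m atTop (𝓝 (P.encode Y)) := by
  refine ⟨?_, fun N e D hD hDC P => ?_⟩
  · obtain ⟨N, e, D, h1, h2, h3⟩ := hC.exists_norNetwork
    exact ⟨N, e, D, h1, h2, h3, GateParams.nonempty D⟩
  · obtain ⟨Y, hY⟩ := hD.exists_satisfies
    have hlt := NORNetwork.lt_of_mem_inputs hD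
    have hD' : ∀ k, k ∉ D.inputs k := fun k hk => lt_irrefl k (hlt k k hk)
    have hX : C.Satisfies fun i => Y (e i) := fun i => by
      rw [← (hDC _).2 Y ⟨fun _ => rfl, fun g _ => hY g⟩ i]
      exact hY (e i)
    refine ⟨fun i => Y (e i), Y, fun X' => ⟨fun h => hC.eq_of_satisfies h hX, fun h => h ▸ hX⟩,
      fun Y' => ⟨fun h => hD.eq_of_satisfies h hY, fun h => h ▸ hY⟩, fun _ => rfl,
      P.isLocallyStable_encode hlt hY, P.isCoordinatewiseStable_encode hlt hY,
      fun p hp hs => P.eq_encode_of_isLocallyStable hlt hY hp hs, ?_⟩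
    filter_upwards [ae_forall_ne 1] with x hx hmem
    exact ⟨P.exists_isSolution hD' hmem, fun m hm hm0 =>
      P.tendsto_encode hlt hm (hm0 ▸ hmem) (hm0 ▸ hx) hY⟩
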